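/- Let $n\ge 1$. For a symmetric $n\times n$ matrix $M$ with eigenvalues $\lambda_1\ge\dots\ge\lambda_n$ put $$a_1(M)=\exp\Big(\Big(1-\frac{4}{\sqrt{4n+1}+1}\Big)\ln\sqrt{1+\lambda_1^2}\Big),\qquad |M|=\Big(\sum_{i,j}M_{ij}^2\Big)^{1/2},$$ and let $\|u\|_{C^{0,1}(B_1(0))}=\sup_{B_1(0)}|u|+\sup_{x\ne z\in B_1(0)}\frac{|u(x)-u(z)|}{|x-z|}$. Let $0<r<1/4$, $A\ge 0$ and $K\ge 0$. Then there are constants $C_1=C_1(r,n,A)$ and $C_2=C_2(r,n,A,K)$ such that the following holds. Let $u\in C^\infty(B_2(0))$, $B_2(0)\subset\mathbb R^n$, solve the special Lagrangian equation $$\sum_{i=1}^n\arctan\lambda_i(D^2u)=\Theta\quad\text{in }B_2(0)$$ for a constant $\Theta\ge (n-2)\frac{\pi}{2}$, with $\|u\|_{C^{0,1}(B_1(0))}\le A$, and let $y\in B_{1/2}(0)$. Then $$\sup_{B_{1/4}(y)}a_1(D^2u)\le C_1(r,n,A)\,\sup_{B_r(y)}a_1(D^2u),$$ and, if $\sup_{B_r(y)}|D^2u|\le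 K$, then $$\sup_{B_{1/4}(y)}|D^2u|\le C_2(r,n,A,K).$$ In particular, $C_1$ and $C_2$ depend neither on $\Theta$ nor on $y$. -/

import Mathlib

open scoped NNReal ENNReal ContDiff

noncomputable section

namespace SLag

/-- The Hessian matrix `D²u(x) = (∂ᵢ∂ⱼ u(x))`. -/
def hessian {n : ℕ} (u : EuclideanSpace ℝ (Fin n) → ℝ) (x : EuclideanSpace ℝ (Fin n)) :
    Matrix (Fin n) (Fin n) ℝ :=
  Matrix.of fun i j =>
    fderiv ℝ (fderiv ℝ u) x (EuclideanSpace.single i 1) (EuclideanSpace.single j 1)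

/-- The Hessian of a function which is `C^∞` on an open set is symmetric there. -/
theorem hessian_isHermitian {n : ℕ} {u : EuclideanSpace ℝ (Fin n) → ℝ}
    {s : Set (EuclideanSpace ℝ (Fin n))} (hs : IsOpen s) (hu : ContDiffOn ℝ ∞ u s)
    {x : EuclideanSpace ℝ (Fin n)} (hx : x ∈ s) : (hessian u x).IsHermitian := by
  have h : ContDiffAt ℝ ∞ u x := hu.contDiffAt (hs.mem_nhds hx)
  have h2 : IsSymmSndFDerivAt ℝ u x := h.isSymmSndFDerivAt (by
    simp only [minSmoothness_of_isRCLikeNormedField]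
    exact WithTop.coe_le_coe.2 (le_top : (2 : ℕ∞) ≤ ⊤))
  ext i j
  simpa [hessian] using
    h2 (EuclideanSpace.single j (1 : ℝ)) (EuclideanSpace.single i (1 : ℝ))

/-- The eigenvalues `λ₁ ≥ λ₂ ≥ ⋯ ≥ λₙ`, with multiplicity, of a real symmetric matrix, indexed
by `0, …, n - 1`. (The value `0` for a matrix that is not symmetric is a placeholder.) -/
def eigenvalue {n : ℕ} (M : Matrix (Fin n) (Fin n) ℝ) (i : Fin n) : ℝ :=
  open Classical in
  if h : M.IsHermitian then h.eigenvalues₀ (Fin.cast (Fintype.card_fin n).symm i) else 0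

/-- The eigenvalues are listed in decreasing order. -/
theorem eigenvalue_antitone {n : ℕ} (M : Matrix (Fin n) (Fin n) ℝ) : Antitone (eigenvalue M) := by
  intro i j hij
  unfold eigenvalue
  split_ifs with h
  · exact h.eigenvalues₀_antitone hij
  · exact le_rfl

/-- `u` solves the special Lagrangian equation `∑ᵢ arctan λᵢ(D²u) = Θ` at every point of `s`. -/
def IsSolutionOn {n : ℕ} (Θ : ℝ) (u : EuclideanSpace ℝ (Fin n) → ℝ)
    (s : Set (EuclideanSpace ℝ (Fin n))) : Prop :=
  ∀ x ∈ s, ∑ i, Real.arctan (eigenvalue (hessian u x) i) = Θ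

/-- The dimensional exponent `1 - 4 / (√(4n+1) + 1)`. -/
def jacobiExponent (n : ℕ) : ℝ := 1 - 4 / (√(4 * (n : ℝ) + 1) + 1)

/-- `b₁ = ln √(1 + λ₁²)`, where `λ₁` is the largest eigenvalue. -/
def b₁ {n : ℕ} [NeZero n] (M : Matrix (Fin n) (Fin n) ℝ) : ℝ :=
  Real.log √(1 + eigenvalue M 0 ^ 2)

/-- `a₁ = exp ((1 - 4 / (√(4n+1) + 1)) b₁)`. -/
def a₁ {n : ℕ} [NeZero n] (M : Matrix (Fin n) (Fin n) ℝ) : ℝ :=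
  Real.exp (jacobiExponent n * b₁ M)

/-- The Euclidean (Hilbert-Schmidt) norm `|M| = (∑ᵢⱼ Mᵢⱼ²)^{1/2}` of a matrix. -/
def matrixNorm {n : ℕ} (M : Matrix (Fin n) (Fin n) ℝ) : ℝ :=
  √(∑ i, ∑ j, M i j ^ 2)

/-- The supremum over `s` of a nonnegative function, as an element of `[0, ∞]`. -/
def supOn {X : Type*} (s : Set X) (f : X → ℝ) : ℝ≥0∞ := ⨆ x ∈ s, ENNReal.ofReal (f x)

/-- The norm `‖u‖_{C^{0,1}(s)} = sup_s |u| + sup_{x ≠ z ∈ s} |u(x) - u(z)| / |x - z|`,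
as an element of `[0, ∞]` (the quotient for `x = z` is `0 / 0 = 0`). -/
def c01Norm {n : ℕ} (u : EuclideanSpace ℝ (Fin n) → ℝ) (s : Set (EuclideanSpace ℝ (Fin n))) :
    ℝ≥0∞ :=
  (⨆ x ∈ s, ‖u x‖ₑ) + ⨆ x ∈ s, ⨆ z ∈ s, edist (u x) (u z) / edist x z

end SLag

end

noncomputable section

open Filter Topology

namespace SLag


/-! In an eigenframe of `D²u` let `L = Σₖ (1 + λₖ²)⁻¹ ∂ₖₖ` be the linearized operator, without
first-order terms. Two facts pull in opposite directions.

Jacobi inequality. For a suitable decreasing `G`, the function `G (λ₁)` is a supersolution of `L`: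
any function touching it from below satisfies `L W ≤ 0` at the contact point
(`sum_mul_le_zero_of_jacobiAt`). Since `λ₁` need not be smooth, it is bounded below by Rayleigh
quotients along test vectors `e₀ + t c`. Their second derivatives, combined with the twice
differentiated equation, reduce the inequality to algebra in the third derivatives
(`exists_test_directions`), which the phase condition settles (`diag_inequality`,
`sub_le_of_phase`).

Barrier. Differentiating the equation once gives `L (∂ᵢ u) = 0`. Hence for `φ = -|x - y|² / 2 - τ
((x - y) · Du - u) + 4 τ² |Du|²` no third derivatives survive in `L φ`, and `exp (c φ)` is strictly
subharmonic wherever `|x - y| ≥ r` (`barrier_algebra`). For small `τ` the function `φ` stays close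
to the paraboloid, uniformly in `Θ`.

Maximize `(exp (c φ) - m) / G (λ₁)` over the closed ball of radius `3/8` about `y`. The maximum is
not on the boundary, where the numerator is nonpositive, nor at an interior point outside `B_r(y)`,
where the two facts contradict each other. So it lies in `B_r(y)`, and comparing values gives the
doubling inequality (`exists_doubling_constant`).

For `n ≥ 3` take `G = 1 / a₁`; the exponent is positive, so a bound on `a₁` bounds `λ₁`, which
dominates the other eigenvalues. For `n = 1` the Hessian is constant. For `n = 2` the exponent
vanishes and `a₁ = 1`, so the Hessian bound needs another route. With `t = tan (Θ / 2)`, doubling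
for `G = 1 / (1 + t λ₁)` controls `1 + t λ₁`, a Pogorelov-type argument bounds `q = (λ₁ - t) / (1 +
t λ₁)` in the interior (`halfangle_bound`), and `λ₁ = t + q (1 + t λ₁)`. -/

/-- `f` is differentiable near `0` and twice differentiable at `0`, with value `a`, first derivative
`b` and second derivative `c` there. -/
def HasJet (f : ℝ → ℝ) (a b c : ℝ) : Prop :=
  ∃ f' : ℝ → ℝ, f 0 = a ∧ f' 0 = b ∧ (∀ᶠ t in 𝓝 0, HasDerivAt f (f' t) t) ∧ HasDerivAt f' c 0

/-! ### Calculus of second-order jets of functions of one variable. -/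

namespace HasJet

variable {f g : ℝ → ℝ} {a b c a' b' c' : ℝ}

theorem const (a : ℝ) : HasJet (fun _ => a) a 0 0 :=
  ⟨fun _ => 0, rfl, rfl, .of_forall fun t => hasDerivAt_const t a, hasDerivAt_const _ _⟩

theorem id : HasJet (fun t => t) 0 1 0 :=
  ⟨fun _ => 1, rfl, rfl, .of_forall fun t => hasDerivAt_id t, hasDerivAt_const _ _⟩

theorem add (hf : HasJet f a b c) (hg : HasJet g a' b' c') :
    HasJet (fun t => f t + g t) (a + a') (b + b') (c + c') := by
  obtain ⟨f', h0, h1, h2, h3⟩ := hf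
  obtain ⟨g', k0, k1, k2, k3⟩ := hg
  refine ⟨fun t => f' t + g' t, by simp [h0, k0], by simp [h1, k1], ?_, h3.add k3⟩
  filter_upwards [h2, k2] with t ht kt using ht.add kt

theorem mul (hf : HasJet f a b c) (hg : HasJet g a' b' c') :
    HasJet (fun t => f t * g t) (a * a') (b * a' + a * b') (c * a' + 2 * b * b' + a * c') := by
  obtain ⟨f', h0, h1, h2, h3⟩ := hf
  obtain ⟨g', k0, k1, k2, k3⟩ := hg
  refine ⟨fun t => f' t * g t + f t * g' t, by simp [h0, k0], by simp [h0, h1, k0, k1], ?_, ?_⟩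
  · filter_upwards [h2, k2] with t ht kt using ht.mul kt
  · have := (h3.mul k2.self_of_nhds).add (h2.self_of_nhds.mul k3)
    convert! this using 1
    rw [h0, h1, k0, k1]; ring

theorem const_mul (r : ℝ) (hf : HasJet f a b c) :
    HasJet (fun t => r * f t) (r * a) (r * b) (r * c) := by
  simpa using (HasJet.const r).mul hf

theorem sub (hf : HasJet f a b c) (hg : HasJet g a' b' c') :
    HasJet (fun t => f t - g t) (a - a') (b - b') (c - c') := by
  simpa [sub_eq_add_neg] using hf.add (hg.const_mul (-1))

theorem sum {ι : Type*} (s : Finset ι) {f : ι → ℝ → ℝ} {a b c : ι → ℝ}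
    (h : ∀ i, HasJet (f i) (a i) (b i) (c i)) :
    HasJet (fun t => ∑ i ∈ s, f i t) (∑ i ∈ s, a i) (∑ i ∈ s, b i) (∑ i ∈ s, c i) := by
  classical
  induction s using Finset.induction_on with
  | empty => simpa using HasJet.const 0
  | insert i s hi ih => simpa [Finset.sum_insert hi] using (h i).add ih

theorem continuousAt (hf : HasJet f a b c) : ContinuousAt f 0 := by
  obtain ⟨f', -, -, h2, -⟩ := hf
  exact h2.self_of_nhds.continuousAt

theorem apply_zero (hf : HasJet f a b c) : f 0 = a := by
  obtain ⟨f', h, -⟩ := hf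
  exact h

theorem tendsto (hf : HasJet f a b c) : Tendsto f (𝓝 0) (𝓝 a) := by
  rw [← hf.apply_zero]
  exact hf.continuousAt

theorem comp {G G' : ℝ → ℝ} {G'' : ℝ} (hG : ∀ᶠ x in 𝓝 a, HasDerivAt G (G' x) x)
    (hG' : HasDerivAt G' G'' a) (hf : HasJet f a b c) :
    HasJet (fun t => G (f t)) (G a) (G' a * b) (G'' * b ^ 2 + G' a * c) := by
  have hc := hf.continuousAt
  obtain ⟨f', h0, h1, h2, h3⟩ := hf
  refine ⟨fun t => G' (f t) * f' t, by simp [h0], by simp [h0, h1], ?_, ?_⟩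
  · have : ∀ᶠ t in 𝓝 0, HasDerivAt G (G' (f t)) (f t) := by
      rw [← h0] at hG
      exact hc.eventually hG
    filter_upwards [h2, this] with t ht kt using kt.comp t ht
  · have h4 : HasDerivAt (fun t => G' (f t)) (G'' * f' 0) 0 :=
      HasDerivAt.comp (h₂ := G') 0 (by rw [h0]; exact hG') h2.self_of_nhds
    convert! h4.mul h3 using 1
    rw [h0, h1]; ring

theorem congr (hf : HasJet f a b c) (h : g =ᶠ[𝓝 0] f) : HasJet g a b c := by
  obtain ⟨f', h0, h1, h2, h3⟩ := hf
  refine ⟨f', by rw [h.self_of_nhds, h0], h1, ?_, h3⟩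
  filter_upwards [h2, h.eventuallyEq_nhds] with t ht kt using ht.congr_of_eventuallyEq kt

/-- If `c` were negative, the second derivative test would make `0` a local maximum as well, so `f`
would be locally constant and `c` would vanish. -/
theorem nonneg_of_isMin (hf : HasJet f a b c) (h : ∀ᶠ t in 𝓝 0, a ≤ f t) : 0 ≤ c := by
  obtain ⟨f', h0, h1, h2, h3⟩ := hf
  by_contra! hc
  have hmin : IsLocalMin f 0 := by
    filter_upwards [h] with t ht
    rwa [h0]
  have hd : deriv f =ᶠ[𝓝 0] f' := by
    filter_upwards [h2] with t ht using ht.deriv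
  have hd0 : deriv f 0 = 0 := hmin.deriv_eq_zero
  have hdd : deriv (deriv f) 0 = c := by rw [hd.deriv_eq, h3.deriv]
  have hmax : IsLocalMax f 0 :=
    isLocalMax_of_deriv_deriv_neg (by rw [hdd]; exact hc) hd0 h2.self_of_nhds.continuousAt
  have hconst : f =ᶠ[𝓝 0] fun _ => f 0 := by
    filter_upwards [hmin, hmax] with t ht kt using le_antisymm kt ht
  have : deriv (deriv f) 0 = 0 := by
    rw [hconst.deriv.deriv_eq]; simp
  rw [hdd] at this
  linarith

end HasJet

/-! ### Derivatives of determinants and inverses along matrix paths. -/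

section Determinant

variable {ι : Type*} [Fintype ι] [DecidableEq ι]

/-- What matters about this Leibniz expansion is that the derivative depends only on `A t` and `B`,
so that any path with the same first-order data may be used to compute it. -/
theorem hasDerivAt_det_aux {A : ℝ → Matrix ι ι ℂ} {B : Matrix ι ι ℂ} {t : ℝ}
    (h : ∀ i j, HasDerivAt (fun s => A s i j) (B i j) t) :
    HasDerivAt (fun s => (A s).det)
      (∑ σ : Equiv.Perm ι, (Equiv.Perm.sign σ : ℂ) *
        ∑ i, (∏ j ∈ Finset.univ.erase i, A t (σ j) j) * B (σ i) i) t := by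
  simp only [Matrix.det_apply']
  refine HasDerivAt.fun_sum fun σ _ => HasDerivAt.const_mul _ ?_
  have := HasDerivAt.fun_finsetProd (u := Finset.univ) (f := fun j s => A s (σ j) j)
    (f' := fun j => B (σ j) j) (x := t) (fun i _ => h (σ i) i)
  simpa [smul_eq_mul] using this

/-- Jacobi's formula along a path of invertible matrices. -/
theorem hasDerivAt_det {A : ℝ → Matrix ι ι ℂ} {B : Matrix ι ι ℂ} {t : ℝ}
    (h : ∀ i j, HasDerivAt (fun s => A s i j) (B i j) t) (hA : IsUnit (A t).det) :
    HasDerivAt (fun s => (A s).det) ((A t).det * ((A t)⁻¹ * B).trace) t := by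
  have h1 := hasDerivAt_det_aux h
  -- Replace the path by its tangent line, where `det (1 + s M) = 1 + s tr M + O(s²)` gives the
  -- derivative.
  have h2 : ∀ i j, HasDerivAt (fun s : ℝ => (A t + ((s - t : ℝ) : ℂ) • B) i j) (B i j) t := by
    intro i j
    have : HasDerivAt (fun s : ℝ => ((s - t : ℝ) : ℂ)) 1 t := by
      simpa using ((hasDerivAt_id t).sub_const t).ofReal_comp
    simpa using (this.mul_const (B i j)).const_add (A t i j)
  have h3 := hasDerivAt_det_aux (A := fun s : ℝ => A t + ((s - t : ℝ) : ℂ) • B) h2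
  simp only [sub_self, Complex.ofReal_zero, zero_smul, add_zero] at h3
  set M := (A t)⁻¹ * B
  have h4 : ∀ s : ℝ, (A t + ((s - t : ℝ) : ℂ) • B).det = (A t).det * (1 + M.trace * ((s - t : ℝ) : ℂ)
      + (Matrix.det (1 + (Polynomial.X : Polynomial ℂ) • M.map Polynomial.C)).divX.divX.eval
        ((s - t : ℝ) : ℂ) * ((s - t : ℝ) : ℂ) ^ 2) := by
    intro s
    rw [← Matrix.det_one_add_smul, ← Matrix.det_mul, mul_add, mul_one, Matrix.mul_smul,
      ← mul_assoc, Matrix.mul_nonsing_inv _ hA, one_mul]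
  have h5 : HasDerivAt (fun s : ℝ => (A t + ((s - t : ℝ) : ℂ) • B).det) ((A t).det * M.trace) t := by
    simp only [h4]
    refine HasDerivAt.const_mul _ ?_
    have e1 : HasDerivAt (fun s : ℝ => ((s - t : ℝ) : ℂ)) 1 t := by
      simpa using ((hasDerivAt_id t).sub_const t).ofReal_comp
    set p := (Matrix.det (1 + (Polynomial.X : Polynomial ℂ) • M.map Polynomial.C)).divX.divX
    have e2 := (p.hasDerivAt ((t - t : ℝ) : ℂ)).comp t e1
    have e3 := ((e1.const_mul M.trace).const_add 1).add (e2.mul (e1.pow 2))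
    convert! e3 using 1
    simp
  rw [h3.unique h5] at h1
  exact h1

attribute [local instance] Matrix.linftyOpNormedRing Matrix.linftyOpNormedAlgebra

theorem hasDerivAt_matrix_inv {A : ℝ → Matrix ι ι ℂ} {B : Matrix ι ι ℂ} {t : ℝ}
    (h : ∀ i j, HasDerivAt (fun s => A s i j) (B i j) t) (hA : IsUnit (A t).det) (i j : ι) :
    HasDerivAt (fun s => (A s)⁻¹ i j) ((-((A t)⁻¹ * B * (A t)⁻¹)) i j) t := by
  have h1 : HasDerivAt A B t := by
    refine hasDerivAt_pi.2 fun i => hasDerivAt_pi.2 fun j => h i j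
  obtain ⟨U, hU⟩ := (Matrix.isUnit_iff_isUnit_det _).2 hA
  have h2 := hasFDerivAt_ringInverse (𝕜 := ℝ) U
  rw [hU] at h2
  have h3 := h2.comp_hasDerivAt t h1
  have h4 : (U⁻¹ : (Matrix ι ι ℂ)ˣ) = (A t)⁻¹ := by
    rw [← hU, Matrix.coe_units_inv]
  have h5 : HasDerivAt (fun s => (A s)⁻¹) (-((A t)⁻¹ * B * (A t)⁻¹)) t := by
    convert! h3 using 1
    · funext s
      simp [Matrix.nonsing_inv_eq_ringInverse]
    · simp [h4]
  exact hasDerivAt_pi.1 (hasDerivAt_pi.1 h5 i) j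

end Determinant


/-! ### The equation as `Im (w det (1 + i D²u)) = 0`, and its variations. -/

section Equation

variable {ι : Type*} [DecidableEq ι]

/-- The complex matrix `1 + i M`. -/
def oneAddI (M : Matrix ι ι ℝ) : Matrix ι ι ℂ := 1 + Complex.I • M.map Complex.ofReal

theorem oneAddI_diagonal (l : ι → ℝ) :
    oneAddI (Matrix.diagonal l) = Matrix.diagonal fun i => 1 + Complex.I * (l i : ℂ) := by
  ext i j
  by_cases h : i = j
  · subst h; simp [oneAddI]
  · simp [oneAddI, h]

theorem one_add_I_mul_ne_zero (x : ℝ) : (1 + Complex.I * (x : ℂ)) ≠ 0 := by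
  intro h
  have := congrArg Complex.re h
  simp at this

theorem inv_one_add_I_mul (x : ℝ) :
    (1 + Complex.I * (x : ℂ))⁻¹ = (1 - Complex.I * x) * (((1 + x ^ 2)⁻¹ : ℝ) : ℂ) := by
  have h : ((1 + x ^ 2 : ℝ) : ℂ) ≠ 0 := by
    exact_mod_cast (by positivity : (1 + x ^ 2 : ℝ) ≠ 0)
  rw [Complex.ofReal_inv, inv_eq_iff_eq_inv, mul_inv, inv_inv, eq_comm,
    inv_mul_eq_iff_eq_mul₀]
  · push_cast
    linear_combination (x : ℂ) ^ 2 * Complex.I_sq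
  · simpa [sub_eq_add_neg] using one_add_I_mul_ne_zero (-x)

variable [Fintype ι]

/-- First and second variation of the special Lagrangian equation along a path of matrices that
is diagonal at time `0`. -/
theorem equation_variation {H : ℝ → Matrix ι ι ℝ} {l : ι → ℝ} {H₁ H₂ : Matrix ι ι ℝ} {w : ℂ}
    (hH : ∀ i j, HasJet (fun t => H t i j) (Matrix.diagonal l i j) (H₁ i j) (H₂ i j))
    (hdet : ∀ᶠ t in 𝓝 0, (w * (oneAddI (H t)).det) ≠ 0 ∧ (w * (oneAddI (H t)).det).im = 0) :
    ∑ i, (1 + l i ^ 2)⁻¹ * H₁ i i = 0 ∧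
    ∑ i, (1 + l i ^ 2)⁻¹ * H₂ i i =
      ∑ i, ∑ j, (l i + l j) * (1 + l i ^ 2)⁻¹ * (1 + l j ^ 2)⁻¹ * (H₁ i j * H₁ j i) := by
  choose H' h0 h1 h2 h3 using hH
  have hg := fun i => inv_one_add_I_mul (l i)
  generalize hgl : (fun i => (1 + l i ^ 2)⁻¹) = g at hg
  have hgl' : ∀ i, (1 + l i ^ 2)⁻¹ = g i := fun i => congrFun hgl i
  simp only [hgl'] at hg ⊢
  have hA : ∀ᶠ t in 𝓝 (0 : ℝ), ∀ i j, HasDerivAt (fun s => oneAddI (H s) i j)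
      (Complex.I * (H' i j t : ℂ)) t := by
    rw [eventually_all]; intro i
    rw [eventually_all]; intro j
    filter_upwards [h2 i j] with t ht
    have := (ht.ofReal_comp.const_mul Complex.I).const_add ((1 : Matrix ι ι ℂ) i j)
    simpa [oneAddI] using this
  -- The number `w det` is real and nonzero along the path, so its logarithmic derivative, the trace
  -- given by Jacobi's formula, is real. Knowing this for all small `t` allows a second
  -- differentiation.
  have htr : ∀ᶠ t in 𝓝 (0 : ℝ), ((oneAddI (H t))⁻¹ *
      (Matrix.of fun i j => Complex.I * (H' i j t : ℂ))).trace.im = 0 := by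
    filter_upwards [hA, hdet.eventually_nhds] with t ht hd
    obtain ⟨hne, him⟩ := hd.self_of_nhds
    have hu : IsUnit (oneAddI (H t)).det := isUnit_iff_ne_zero.2 (right_ne_zero_of_mul hne)
    have e1 := (hasDerivAt_det (B := Matrix.of fun i j => Complex.I * (H' i j t : ℂ))
      ht hu).const_mul w
    have e2 : HasDerivAt (fun s => (w * (oneAddI (H s)).det).im) _ t :=
      (Complex.imCLM.hasFDerivAt.comp_hasDerivAt t e1)
    have e3 : (fun s => (w * (oneAddI (H s)).det).im) =ᶠ[𝓝 t] fun _ => 0 := by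
      filter_upwards [hd] with s hs using hs.2
    have e4 := (e2.congr_of_eventuallyEq e3.symm).unique (hasDerivAt_const t 0)
    rw [← mul_assoc] at e4
    simp only [Complex.imCLM_apply, Complex.mul_im, him, zero_mul, add_zero] at e4
    rcases mul_eq_zero.1 e4 with h | h
    · exact absurd (Complex.ext h him) hne
    · exact h
  have hH0 : H 0 = Matrix.diagonal l := by ext i j; exact h0 i j
  have hinv : (oneAddI (H 0))⁻¹ = Matrix.diagonal fun i => (1 + Complex.I * (l i : ℂ))⁻¹ := by
    rw [hH0, oneAddI_diagonal]
    refine Matrix.inv_eq_right_inv ?_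
    rw [Matrix.diagonal_mul_diagonal, ← Matrix.diagonal_one]
    congr 1; ext i
    exact mul_inv_cancel₀ (one_add_I_mul_ne_zero _)
  have hd0 : IsUnit (oneAddI (H 0)).det :=
    isUnit_iff_ne_zero.2 (right_ne_zero_of_mul hdet.self_of_nhds.1)
  constructor
  · have := htr.self_of_nhds
    rw [hinv] at this
    simp only [Matrix.trace, Matrix.diag_apply, Matrix.diagonal_mul, Matrix.of_apply, h1,
      hg, Complex.im_sum] at this
    rw [← this]
    refine Finset.sum_congr rfl fun i _ => ?_
    simp [Complex.mul_im, Complex.mul_re]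
  · have e1 : HasDerivAt (fun t => ∑ i, ∑ j, (oneAddI (H t))⁻¹ i j * (Complex.I * (H' j i t : ℂ)))
        (∑ i, ∑ j, ((-((oneAddI (H 0))⁻¹ * (Matrix.of fun i j => Complex.I * (H' i j 0 : ℂ))
          * (oneAddI (H 0))⁻¹)) i j * (Complex.I * (H' j i 0 : ℂ)) +
          (oneAddI (H 0))⁻¹ i j * (Complex.I * (H₂ j i : ℂ)))) 0 := by
      refine HasDerivAt.fun_sum fun i _ => HasDerivAt.fun_sum fun j _ => ?_
      exact (hasDerivAt_matrix_inv hA.self_of_nhds hd0 i j).mul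
        ((h3 j i).ofReal_comp.const_mul Complex.I)
    have e2 := Complex.imCLM.hasFDerivAt.comp_hasDerivAt 0 e1
    have e3 : (fun t => ∑ i, ∑ j, (oneAddI (H t))⁻¹ i j * (Complex.I * (H' j i t : ℂ))) =
        fun t => ((oneAddI (H t))⁻¹ *
      (Matrix.of fun i j => Complex.I * (H' i j t : ℂ))).trace := by
      ext t
      simp [Matrix.trace, Matrix.mul_apply]
    rw [e3] at e2
    have e4 := (e2.congr_of_eventuallyEq (f₁ := fun _ => 0) (by
      filter_upwards [htr] with t ht
      simpa using ht.symm)).unique (hasDerivAt_const (0 : ℝ) (0 : ℝ))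
    simp only [hinv, h1, hg, Complex.imCLM_apply, Complex.im_sum, Matrix.neg_apply,
      Matrix.mul_diagonal, Matrix.diagonal_mul, Matrix.of_apply, Complex.add_im,
      Finset.sum_add_distrib] at e4
    have e5 : ∀ i j, (Matrix.diagonal (fun i => (1 - Complex.I * (l i : ℂ)) *
        (g i : ℂ)) i j * (Complex.I * (H₂ j i : ℂ))).im =
        if i = j then g i * H₂ i i else 0 := by
      intro i j
      by_cases h : i = j
      · subst h; simp [Complex.mul_im, Complex.mul_re]
      · simp [h]
    simp only [e5, Finset.sum_ite_eq, Finset.mem_univ, if_true] at e4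
    have e6 : ∑ i, g i * H₂ i i = _ := eq_neg_of_add_eq_zero_right e4
    rw [e6, ← Finset.sum_neg_distrib]
    refine Finset.sum_congr rfl fun i _ => ?_
    rw [← Finset.sum_neg_distrib]
    refine Finset.sum_congr rfl fun j _ => ?_
    simp [Complex.mul_im, Complex.mul_re]
    ring

end Equation


/-! ### Eigenframes, the phase of `det (1 + i M)`, and Rayleigh quotients. -/

section Frame

variable {n : ℕ} {M : Matrix (Fin n) (Fin n) ℝ}

theorem exists_eigenframe (hM : M.IsHermitian) :
    ∃ e : OrthonormalBasis (Fin n) ℝ (EuclideanSpace ℝ (Fin n)),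
      ∀ i, M.mulVec (e i) = eigenvalue M i • (e i : Fin n → ℝ) := by
  have hs := Matrix.isSymmetric_toEuclideanLin_iff.2 hM
  refine ⟨(hs.eigenvectorBasis finrank_euclideanSpace).reindex (finCongr (Fintype.card_fin n)),
    fun i => ?_⟩
  have h := hs.apply_eigenvectorBasis finrank_euclideanSpace
    (Fin.cast (Fintype.card_fin n).symm i)
  have h2 := congrArg (fun v : EuclideanSpace ℝ (Fin n) => (v : Fin n → ℝ)) h
  simp only [eigenvalue, dif_pos hM, Matrix.IsHermitian.eigenvalues₀]
  rw [OrthonormalBasis.reindex_apply]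
  exact h2

/-- The matrix whose columns are the vectors of an orthonormal basis. -/
def frameMatrix (e : OrthonormalBasis (Fin n) ℝ (EuclideanSpace ℝ (Fin n))) :
    Matrix (Fin n) (Fin n) ℝ := Matrix.of fun a i => e i a

variable (e : OrthonormalBasis (Fin n) ℝ (EuclideanSpace ℝ (Fin n)))

theorem frameMatrix_transpose_mul : (frameMatrix e).transpose * frameMatrix e = 1 := by
  ext i j
  have := e.inner_eq_ite i j
  simp only [PiLp.inner_apply, RCLike.inner_apply, conj_trivial] at this
  simp only [Matrix.mul_apply, Matrix.transpose_apply, frameMatrix, Matrix.of_apply,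
    Matrix.one_apply]
  rw [← this]
  exact Finset.sum_congr rfl fun _ _ => mul_comm _ _

theorem frameMatrix_mul_transpose : frameMatrix e * (frameMatrix e).transpose = 1 :=
  mul_eq_one_comm.1 (frameMatrix_transpose_mul e)

theorem conj_frameMatrix_apply (N : Matrix (Fin n) (Fin n) ℝ) (i j : Fin n) :
    ((frameMatrix e).transpose * N * frameMatrix e) i j =
      dotProduct (e i : Fin n → ℝ) (N.mulVec (e j)) := by
  rw [mul_assoc, Matrix.mul_apply]
  simp [dotProduct, frameMatrix, Matrix.mul_apply, Matrix.mulVec]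

variable {e}

theorem conj_frameMatrix_eq_diagonal {l : Fin n → ℝ}
    (he : ∀ i, M.mulVec (e i) = l i • (e i : Fin n → ℝ)) :
    (frameMatrix e).transpose * M * frameMatrix e = Matrix.diagonal l := by
  ext i j
  rw [conj_frameMatrix_apply, he, dotProduct_smul]
  have := e.inner_eq_ite j i
  simp only [PiLp.inner_apply, RCLike.inner_apply, conj_trivial] at this
  simp only [dotProduct, this, smul_eq_mul]
  by_cases h : i = j
  · subst h; simp
  · simp [h, Ne.symm h]

theorem det_oneAddI_conj {U : Matrix (Fin n) (Fin n) ℝ} (hU : U.transpose * U = 1) :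
    (oneAddI (U.transpose * M * U)).det = (oneAddI M).det := by
  have h1 : (U.map Complex.ofReal).transpose * U.map Complex.ofReal = 1 := by
    have := congrArg (fun N : Matrix (Fin n) (Fin n) ℝ => N.map Complex.ofRealHom) hU
    simpa [Matrix.map_mul, Matrix.transpose_map] using! this
  have h2 : oneAddI (U.transpose * M * U) =
      (U.map Complex.ofReal).transpose * oneAddI M * U.map Complex.ofReal := by
    have : (U.transpose * M * U).map Complex.ofReal = (U.map Complex.ofReal).transpose *
        M.map Complex.ofReal * U.map Complex.ofReal := by
      have h3 := Matrix.map_mul (L := U.transpose * M) (M := U) (f := Complex.ofRealHom)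
      rw [Matrix.map_mul (L := U.transpose) (M := M)] at h3
      exact h3
    rw [oneAddI, oneAddI, this, Matrix.mul_add, Matrix.add_mul, Matrix.mul_one, h1,
      Matrix.mul_smul, Matrix.smul_mul]
  rw [h2, Matrix.det_mul, Matrix.det_mul, mul_comm, ← mul_assoc, ← Matrix.det_mul,
    mul_eq_one_comm.1 h1, Matrix.det_one, one_mul]

theorem one_add_I_mul_eq (x : ℝ) :
    1 + Complex.I * (x : ℂ) = (√(1 + x ^ 2) : ℝ) * Complex.exp (Complex.I * Real.arctan x) := by
  have h : √(1 + x ^ 2) ≠ 0 := by positivity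
  rw [mul_comm Complex.I (Real.arctan x : ℂ), Complex.exp_mul_I, ← Complex.ofReal_cos,
    ← Complex.ofReal_sin, Real.cos_arctan, Real.sin_arctan]
  push_cast
  have h' : ((√(1 + x ^ 2) : ℝ) : ℂ) ≠ 0 := by exact_mod_cast h
  field_simp

/-- Each factor `1 + i λ` equals `√(1 + λ²) exp (i arctan λ)`. This turns the equation for the
eigenvalues into one that is polynomial in the matrix entries and can be differentiated without
differentiating eigenvalues. -/
theorem det_oneAddI_phase (hM : M.IsHermitian) {Θ : ℝ}
    (h : ∑ i, Real.arctan (eigenvalue M i) = Θ) :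
    Complex.exp (-(Complex.I * Θ)) * (oneAddI M).det =
      ((∏ i, √(1 + eigenvalue M i ^ 2) : ℝ) : ℂ) := by
  obtain ⟨e, he⟩ := exists_eigenframe hM
  rw [← det_oneAddI_conj (frameMatrix_transpose_mul e), conj_frameMatrix_eq_diagonal he,
    oneAddI_diagonal, Matrix.det_diagonal]
  simp only [one_add_I_mul_eq]
  rw [Finset.prod_mul_distrib, ← Complex.exp_sum, ← Finset.mul_sum, ← Complex.ofReal_sum, h,
    mul_left_comm, ← Complex.exp_add, neg_add_cancel, Complex.exp_zero, mul_one]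
  push_cast
  rfl

theorem matrixNorm_eq (hM : M.IsHermitian) : matrixNorm M = √(∑ i, eigenvalue M i ^ 2) := by
  obtain ⟨e, he⟩ := exists_eigenframe hM
  have h1 := conj_frameMatrix_eq_diagonal he
  have hMt : M.transpose = M := Matrix.isHermitian_iff_isSymm.1 hM
  have h2 : (M * M).trace = ∑ i, eigenvalue M i ^ 2 := by
    have h3 : (frameMatrix e).transpose * (M * M) * frameMatrix e =
        Matrix.diagonal fun i => eigenvalue M i * eigenvalue M i := by
      rw [← Matrix.diagonal_mul_diagonal, ← h1]
      calc _ = (frameMatrix e).transpose * M * 1 * M * frameMatrix e := by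
              simp only [mul_assoc, one_mul]
        _ = _ := by rw [← frameMatrix_mul_transpose e]; simp only [mul_assoc]
    have h4 := congrArg Matrix.trace h3
    rw [Matrix.trace_mul_comm, ← mul_assoc, frameMatrix_mul_transpose, one_mul,
      Matrix.trace_diagonal] at h4
    simpa [sq] using h4
  rw [matrixNorm, ← h2]
  congr 1
  simp only [Matrix.trace, Matrix.diag_apply, Matrix.mul_apply]
  refine Finset.sum_congr rfl fun i _ => Finset.sum_congr rfl fun j _ => ?_
  rw [sq]
  congr 1
  exact (congrFun (congrFun hMt j) i)

theorem dotProduct_mulVec_le [NeZero n] (hM : M.IsHermitian) (v : EuclideanSpace ℝ (Fin n)) :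
    dotProduct (v : Fin n → ℝ) (M.mulVec v) ≤ eigenvalue M 0 * ‖v‖ ^ 2 := by
  obtain ⟨e, he⟩ := exists_eigenframe hM
  have hv : (v : Fin n → ℝ) = ∑ i, (e.repr v i) • (e i : Fin n → ℝ) := by
    have := e.sum_repr v
    have h2 := congrArg (fun v : EuclideanSpace ℝ (Fin n) => (v : Fin n → ℝ)) this
    simpa using h2.symm
  have hMv : M.mulVec v = ∑ i, (e.repr v i * eigenvalue M i) • (e i : Fin n → ℝ) := by
    conv_lhs => rw [hv]
    rw [Matrix.mulVec_sum]
    simp [Matrix.mulVec_smul, he, smul_smul]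
  have hdot : ∀ i, dotProduct (v : Fin n → ℝ) (e i) = e.repr v i := by
    intro i
    rw [e.repr_apply_apply]
    simp [PiLp.inner_apply, dotProduct]
  have hn : ‖v‖ ^ 2 = ∑ i, e.repr v i ^ 2 := by
    rw [← e.repr.norm_map v, EuclideanSpace.norm_sq_eq]
    simp
  rw [hMv, dotProduct_sum, hn, Finset.mul_sum]
  refine Finset.sum_le_sum fun i _ => ?_
  rw [dotProduct_smul, hdot, smul_eq_mul]
  have := eigenvalue_antitone M (Fin.zero_le i)
  nlinarith [sq_nonneg (e.repr v i)]

/-- The top eigenvector of `N` is a test vector for `M`. Used in both directions, this gives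
continuity of `λ₁`. -/
theorem eigenvalue_zero_le_add [NeZero n] {N : Matrix (Fin n) (Fin n) ℝ} (hM : M.IsHermitian)
    (hN : N.IsHermitian) :
    eigenvalue N 0 ≤ eigenvalue M 0 + ∑ i, ∑ j, |N i j - M i j| := by
  obtain ⟨e, he⟩ := exists_eigenframe hN
  have h1 := dotProduct_mulVec_le hM (e 0)
  have h2 : dotProduct (e 0 : Fin n → ℝ) (N.mulVec (e 0)) = eigenvalue N 0 := by
    rw [← conj_frameMatrix_apply, conj_frameMatrix_eq_diagonal he]; simp
  have h3 : dotProduct (e 0 : Fin n → ℝ) ((N - M).mulVec (e 0)) ≤ ∑ i, ∑ j, |N i j - M i j| := by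
    simp only [dotProduct, Matrix.mulVec, Finset.mul_sum]
    refine Finset.sum_le_sum fun i _ => Finset.sum_le_sum fun j _ => ?_
    have hi : |e 0 i| ≤ 1 := by
      have := PiLp.norm_apply_le (e 0) i
      rwa [e.orthonormal.1 0, Real.norm_eq_abs] at this
    have hj : |e 0 j| ≤ 1 := by
      have := PiLp.norm_apply_le (e 0) j
      rwa [e.orthonormal.1 0, Real.norm_eq_abs] at this
    calc _ ≤ |e 0 i * ((N - M) i j * e 0 j)| := le_abs_self _
      _ = |e 0 i| * |N i j - M i j| * |e 0 j| := by
        rw [abs_mul, abs_mul, Matrix.sub_apply, mul_assoc]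
      _ ≤ 1 * |N i j - M i j| * 1 := by gcongr
      _ = _ := by ring
  rw [Matrix.sub_mulVec, dotProduct_sub, h2] at h3
  rw [e.orthonormal.1 0] at h1
  linarith

end Frame


/-! ### Directional derivatives of `u` up to order four in a frame. -/

section Derivatives

variable {n : ℕ}

/-- The derivative of `f` in the direction `v`. -/
def dirDeriv (v : EuclideanSpace ℝ (Fin n)) (f : EuclideanSpace ℝ (Fin n) → ℝ) :
    EuclideanSpace ℝ (Fin n) → ℝ := fun x => fderiv ℝ f x v

variable {s : Set (EuclideanSpace ℝ (Fin n))} {f g : EuclideanSpace ℝ (Fin n) → ℝ}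
  {x : EuclideanSpace ℝ (Fin n)} (v w : EuclideanSpace ℝ (Fin n))

theorem contDiffOn_dirDeriv (hs : IsOpen s) (hf : ContDiffOn ℝ ∞ f s) :
    ContDiffOn ℝ ∞ (dirDeriv v f) s :=
  (hf.fderiv_of_isOpen hs (by simp)).clm_apply contDiffOn_const

theorem dirDeriv_congr (hs : IsOpen s) (h : Set.EqOn f g s) :
    Set.EqOn (dirDeriv v f) (dirDeriv v g) s := by
  intro x hx
  have : f =ᶠ[𝓝 x] g := by
    filter_upwards [hs.mem_nhds hx] with y hy using h hy
  simp only [dirDeriv, this.fderiv_eq]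

theorem dirDeriv_dirDeriv (hs : IsOpen s) (hf : ContDiffOn ℝ ∞ f s) (hx : x ∈ s) :
    dirDeriv v (dirDeriv w f) x = fderiv ℝ (fderiv ℝ f) x v w := by
  have h1 : DifferentiableAt ℝ (fderiv ℝ f) x :=
    ((hf.fderiv_of_isOpen hs (m := ∞) (by simp)).contDiffAt (hs.mem_nhds hx)).differentiableAt
      (by simp)
  have h2 := h1.hasFDerivAt.clm_apply (hasFDerivAt_const w x)
  have h3 : HasFDerivAt (dirDeriv w f) _ x := h2
  rw [dirDeriv, h3.fderiv]
  simp

theorem dirDeriv_comm (hs : IsOpen s) (hf : ContDiffOn ℝ ∞ f s) :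
    Set.EqOn (dirDeriv v (dirDeriv w f)) (dirDeriv w (dirDeriv v f)) s := by
  intro x hx
  rw [dirDeriv_dirDeriv v w hs hf hx, dirDeriv_dirDeriv w v hs hf hx]
  refine (hf.contDiffAt (hs.mem_nhds hx)).isSymmSndFDerivAt ?_ v w
  simp only [minSmoothness_of_isRCLikeNormedField]
  exact WithTop.coe_le_coe.2 (le_top : (2 : ℕ∞) ≤ ⊤)

theorem tendsto_line (x v : EuclideanSpace ℝ (Fin n)) :
    Tendsto (fun t : ℝ => x + t • v) (𝓝 0) (𝓝 x) := by
  have : Continuous fun t : ℝ => x + t • v := by fun_prop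
  simpa using this.tendsto 0

theorem hasDerivAt_line (hs : IsOpen s) (hf : ContDiffOn ℝ ∞ f s) {t : ℝ} (ht : x + t • v ∈ s) :
    HasDerivAt (fun t : ℝ => f (x + t • v)) (dirDeriv v f (x + t • v)) t := by
  have h1 : HasDerivAt (fun t : ℝ => x + t • v) v t := by
    simpa using ((hasDerivAt_id t).smul_const v).const_add x
  have h2 : DifferentiableAt ℝ f (x + t • v) :=
    (hf.contDiffAt (hs.mem_nhds ht)).differentiableAt (by simp)
  exact h2.hasFDerivAt.comp_hasDerivAt t h1

theorem hasJet_line (hs : IsOpen s) (hf : ContDiffOn ℝ ∞ f s) (hx : x ∈ s) :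
    HasJet (fun t : ℝ => f (x + t • v)) (f x) (dirDeriv v f x) (dirDeriv v (dirDeriv v f) x) := by
  refine ⟨fun t => dirDeriv v f (x + t • v), by simp, by simp, ?_, ?_⟩
  · filter_upwards [(tendsto_line x v).eventually (hs.mem_nhds hx)] with t ht
    exact hasDerivAt_line v hs hf ht
  · have := hasDerivAt_line (x := x) (t := 0) v hs (contDiffOn_dirDeriv v hs hf) (by simpa using hx)
    simpa using this

theorem fderiv_fderiv_eq_dotProduct :
    fderiv ℝ (fderiv ℝ f) x v w =
      dotProduct (v : Fin n → ℝ) ((hessian f x).mulVec (w : Fin n → ℝ)) := by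
  have hv : ∀ v : EuclideanSpace ℝ (Fin n), v = ∑ i, v i • EuclideanSpace.single i (1 : ℝ) := by
    intro v
    ext j
    simp [Finset.sum_apply, Pi.single_apply]
  conv_lhs => rw [hv v, hv w]
  simp only [map_sum, map_smul, sum_apply, smul_apply,
    dotProduct, Matrix.mulVec, hessian, Matrix.of_apply, smul_eq_mul, Finset.mul_sum]
  rw [Finset.sum_comm]
  refine Finset.sum_congr rfl fun i _ => Finset.sum_congr rfl fun j _ => ?_
  ring

/-- The Hessian in an orthonormal frame. -/
theorem dirDeriv_dirDeriv_frame (hs : IsOpen s) (hf : ContDiffOn ℝ ∞ f s) (hx : x ∈ s)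
    (e : OrthonormalBasis (Fin n) ℝ (EuclideanSpace ℝ (Fin n))) (i j : Fin n) :
    dirDeriv (e i) (dirDeriv (e j) f) x =
      ((frameMatrix e).transpose * hessian f x * frameMatrix e) i j := by
  rw [dirDeriv_dirDeriv _ _ hs hf hx, fderiv_fderiv_eq_dotProduct, conj_frameMatrix_apply]

theorem dirDeriv_dirDeriv_eigenframe (hs : IsOpen s) (hf : ContDiffOn ℝ ∞ f s) (hx : x ∈ s)
    {e : OrthonormalBasis (Fin n) ℝ (EuclideanSpace ℝ (Fin n))} {l : Fin n → ℝ}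
    (he : ∀ i, (hessian f x).mulVec (e i) = l i • (e i : Fin n → ℝ)) (i j : Fin n) :
    dirDeriv (e i) (dirDeriv (e j) f) x = Matrix.diagonal l i j := by
  rw [dirDeriv_dirDeriv_frame hs hf hx, conj_frameMatrix_eq_diagonal he]

/-- The third derivatives in a frame. -/
def thirdDeriv (f : EuclideanSpace ℝ (Fin n) → ℝ) (x : EuclideanSpace ℝ (Fin n))
    (e : OrthonormalBasis (Fin n) ℝ (EuclideanSpace ℝ (Fin n))) (i j k : Fin n) : ℝ :=
  dirDeriv (e k) (dirDeriv (e i) (dirDeriv (e j) f)) x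

theorem thirdDeriv_swap₁₂ (hs : IsOpen s) (hf : ContDiffOn ℝ ∞ f s) (hx : x ∈ s)
    (e : OrthonormalBasis (Fin n) ℝ (EuclideanSpace ℝ (Fin n))) (i j k : Fin n) :
    thirdDeriv f x e i j k = thirdDeriv f x e j i k :=
  dirDeriv_congr _ hs (dirDeriv_comm _ _ hs hf) hx

theorem thirdDeriv_swap₁₃ (hs : IsOpen s) (hf : ContDiffOn ℝ ∞ f s) (hx : x ∈ s)
    (e : OrthonormalBasis (Fin n) ℝ (EuclideanSpace ℝ (Fin n))) (i j k : Fin n) :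
    thirdDeriv f x e i j k = thirdDeriv f x e k j i :=
  dirDeriv_comm _ _ hs (contDiffOn_dirDeriv _ hs hf) hx

variable {Θ : ℝ}

/-- The path is the Hessian along the line through `x` in direction `eₖ`, written in the fixed
eigenframe at `x`. The first identity says that the components of `Du` are annihilated by `L`; in
the second, commuting derivatives has turned `∂ₖₖ uᵢᵢ` into `∂ᵢᵢ uₖₖ`. -/
theorem equation_variation_frame (hs : IsOpen s) (hf : ContDiffOn ℝ ∞ f s)
    (hsol : IsSolutionOn Θ f s) (hx : x ∈ s)
    {e : OrthonormalBasis (Fin n) ℝ (EuclideanSpace ℝ (Fin n))} {l : Fin n → ℝ}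
    (he : ∀ i, (hessian f x).mulVec (e i) = l i • (e i : Fin n → ℝ)) (k : Fin n) :
    ∑ i, (1 + l i ^ 2)⁻¹ * thirdDeriv f x e i i k = 0 ∧
    ∑ i, (1 + l i ^ 2)⁻¹ *
        dirDeriv (e i) (dirDeriv (e i) (dirDeriv (e k) (dirDeriv (e k) f))) x =
      ∑ i, ∑ j, (l i + l j) * (1 + l i ^ 2)⁻¹ * (1 + l j ^ 2)⁻¹ * thirdDeriv f x e i j k ^ 2 := by
  have hsmooth : ∀ i j, ContDiffOn ℝ ∞ (dirDeriv (e i) (dirDeriv (e j) f)) s := fun i j =>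
    contDiffOn_dirDeriv _ hs (contDiffOn_dirDeriv _ hs hf)
  have hline := (tendsto_line x (e k)).eventually (hs.mem_nhds hx)
  have h := equation_variation
    (H := fun t => (frameMatrix e).transpose * hessian f (x + t • e k) * frameMatrix e) (l := l)
    (H₁ := fun i j => thirdDeriv f x e i j k)
    (H₂ := fun i j => dirDeriv (e k) (dirDeriv (e k) (dirDeriv (e i) (dirDeriv (e j) f))) x)
    (w := Complex.exp (-(Complex.I * Θ))) ?_ ?_
  · refine ⟨h.1, ?_⟩
    have e1 : ∀ i, dirDeriv (e i) (dirDeriv (e i) (dirDeriv (e k) (dirDeriv (e k) f))) x =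
        dirDeriv (e k) (dirDeriv (e k) (dirDeriv (e i) (dirDeriv (e i) f))) x := by
      intro i
      have a1 : Set.EqOn (dirDeriv (e i) (dirDeriv (e k) (dirDeriv (e k) f)))
          (dirDeriv (e k) (dirDeriv (e k) (dirDeriv (e i) f))) s :=
        (dirDeriv_comm _ _ hs (contDiffOn_dirDeriv _ hs hf)).trans
          (dirDeriv_congr _ hs (dirDeriv_comm _ _ hs hf))
      have a2 := (dirDeriv_congr (e i) hs a1).trans
        ((dirDeriv_comm (e i) (e k) hs (hsmooth k i)).trans (dirDeriv_congr (e k) hs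
          (dirDeriv_comm (e i) (e k) hs (contDiffOn_dirDeriv _ hs hf))))
      exact a2 hx
    simp only [e1]
    rw [h.2]
    refine Finset.sum_congr rfl fun i _ => Finset.sum_congr rfl fun j _ => ?_
    rw [thirdDeriv_swap₁₂ hs hf hx e j i k, ← sq]
  · intro i j
    have := hasJet_line (e k) hs (hsmooth i j) hx
    rw [dirDeriv_dirDeriv_eigenframe hs hf hx he] at this
    refine this.congr ?_
    filter_upwards [hline] with t ht
    rw [dirDeriv_dirDeriv_frame hs hf ht]
  · filter_upwards [hline] with t ht
    have hM := hessian_isHermitian hs hf ht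
    rw [det_oneAddI_conj (frameMatrix_transpose_mul e), det_oneAddI_phase hM (hsol _ ht)]
    refine ⟨?_, Complex.ofReal_im _⟩
    exact_mod_cast (Finset.prod_pos fun i _ => by positivity).ne'

/-- Jet of a Rayleigh quotient along a curve of test vectors. -/
theorem hasJet_rayleigh [NeZero n] {H : ℝ → Matrix (Fin n) (Fin n) ℝ} {l : Fin n → ℝ}
    {H₁ H₂ : Matrix (Fin n) (Fin n) ℝ} (hsymm : ∀ i j, H₁ i j = H₁ j i)
    (hH : ∀ i j, HasJet (fun t => H t i j) (Matrix.diagonal l i j) (H₁ i j) (H₂ i j))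
    (c : Fin n → ℝ) (hc : c 0 = 0) :
    HasJet (fun t => (∑ i, ∑ j, ((if i = 0 then 1 else 0) + t * c i) *
        ((if j = 0 then 1 else 0) + t * c j) * H t i j) *
        (∑ i, ((if i = 0 then 1 else 0) + t * c i) ^ 2)⁻¹)
      (l 0) (H₁ 0 0) (H₂ 0 0 + ∑ j, (4 * c j * H₁ 0 j - 2 * c j ^ 2 * (l 0 - l j))) := by
  have hω : ∀ i : Fin n, HasJet (fun t => (if i = 0 then 1 else 0) + t * c i)
      (if i = 0 then 1 else 0) (c i) 0 := by
    intro i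
    simpa using (HasJet.const (if i = 0 then (1 : ℝ) else 0)).add
      (HasJet.id.mul (HasJet.const (c i)))
  have hN := HasJet.sum Finset.univ fun i => HasJet.sum Finset.univ fun j =>
    ((hω i).mul (hω j)).mul (hH i j)
  have hD := HasJet.sum Finset.univ fun i => (hω i).mul (hω i)
  have hD' : HasJet (fun t => ∑ i, ((if i = 0 then 1 else 0) + t * c i) ^ 2) 1 0
      (2 * ∑ i, c i ^ 2) := by
    convert! hD using 1
    · funext t; simp only [sq]
    · simp
    · simp [Finset.sum_add_distrib, hc]
    · rw [Finset.mul_sum]; refine Finset.sum_congr rfl fun i _ => ?_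
      ring
  have hinv : HasJet (fun t => (∑ i, ((if i = 0 then 1 else 0) + t * c i) ^ 2)⁻¹) 1 0
      (-(2 * ∑ i, c i ^ 2)) := by
    have h1 : ∀ᶠ x in 𝓝 (1 : ℝ), HasDerivAt (fun x : ℝ => x⁻¹) (-(x ^ 2)⁻¹) x := by
      filter_upwards [eventually_ne_nhds one_ne_zero] with x hx using hasDerivAt_inv hx
    have h2 : HasDerivAt (fun x : ℝ => -(x ^ 2)⁻¹) 2 1 := by
      have := ((hasDerivAt_pow 2 (1 : ℝ)).inv (by norm_num)).neg
      convert! this using 1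
      norm_num
    simpa using hD'.comp h1 h2
  convert! hN.mul hinv using 1
  · simp [Matrix.diagonal_apply]
  · simp [Matrix.diagonal_apply, add_mul, Finset.sum_add_distrib, hc]
  · have e1 : ∑ i, ∑ j, (c i * (if j = (0 : Fin n) then (1 : ℝ) else 0) +
        (if i = 0 then 1 else 0) * c j) * H₁ i j = 2 * ∑ j, c j * H₁ 0 j := by
      simp [add_mul, Finset.sum_add_distrib, hsymm _ 0]
      ring
    have e2 : ∑ i, ∑ j, c i * c j * Matrix.diagonal l i j = ∑ i, c i ^ 2 * l i := by
      refine Finset.sum_congr rfl fun i _ => ?_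
      simp [Matrix.diagonal_apply, sq]
    have e3 : ∑ i, ∑ j, (if i = (0 : Fin n) then (1 : ℝ) else 0) * (if j = 0 then 1 else 0) *
        Matrix.diagonal l i j = l 0 := by
      simp [Matrix.diagonal_apply]
    have e4 : ∑ i, ∑ j, (if i = (0 : Fin n) then (1 : ℝ) else 0) * (if j = 0 then 1 else 0) *
        H₂ i j = H₂ 0 0 := by
      simp
    rw [e3]
    simp only [zero_mul, zero_add, mul_zero, add_zero, mul_one]
    have e5 : ∀ i j, 2 * c i * c j * Matrix.diagonal l i j +
        2 * (c i * (if j = (0 : Fin n) then (1 : ℝ) else 0) + (if i = 0 then 1 else 0) * c j) *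
          H₁ i j + (if i = 0 then 1 else 0) * (if j = 0 then 1 else 0) * H₂ i j =
        2 * (c i * c j * Matrix.diagonal l i j) + 2 * ((c i * (if j = (0 : Fin n) then (1 : ℝ) else 0)
          + (if i = 0 then 1 else 0) * c j) * H₁ i j) +
        (if i = 0 then 1 else 0) * (if j = 0 then 1 else 0) * H₂ i j := fun i j => by ring
    simp only [e5, Finset.sum_add_distrib, ← Finset.mul_sum, e1, e2, e4]
    simp only [Finset.sum_sub_distrib, mul_sub, Finset.mul_sum]
    have : ∑ j, 4 * c j * H₁ 0 j = ∑ i, 2 * (2 * (c i * H₁ 0 i)) :=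
      Finset.sum_congr rfl fun j _ => by ring
    rw [this]
    have : ∑ j, 2 * c j ^ 2 * l j = ∑ i, 2 * (c i ^ 2 * l i) :=
      Finset.sum_congr rfl fun j _ => by ring
    rw [this]
    have : l 0 * -∑ i, 2 * c i ^ 2 = - ∑ j, 2 * c j ^ 2 * l 0 := by
      rw [mul_neg, Finset.mul_sum]
      congr 1
      exact Finset.sum_congr rfl fun j _ => by ring
    rw [this]
    ring

end Derivatives


/-! ### Touching `G (λ₁)` from below. -/

section MaximumPrinciple

variable {n : ℕ} [NeZero n] {s : Set (EuclideanSpace ℝ (Fin n))}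
  {f : EuclideanSpace ℝ (Fin n) → ℝ} {x : EuclideanSpace ℝ (Fin n)}

theorem continuousOn_eigenvalue_zero (hs : IsOpen s) (hf : ContDiffOn ℝ ∞ f s) :
    ContinuousOn (fun z => eigenvalue (hessian f z) 0) s := by
  intro x hx
  have hc : ∀ i j, ContinuousWithinAt (fun z => hessian f z i j) s x := by
    intro i j
    have h1 := (contDiffOn_dirDeriv (EuclideanSpace.single i (1 : ℝ)) hs
      (contDiffOn_dirDeriv (EuclideanSpace.single j (1 : ℝ)) hs hf)).continuousOn
    refine (h1.congr fun z hz => ?_) x hx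
    rw [dirDeriv_dirDeriv _ _ hs hf hz]
    rfl
  have h0 : Tendsto (fun z => ∑ i, ∑ j, |hessian f z i j - hessian f x i j|) (𝓝[s] x) (𝓝 0) := by
    have : ContinuousWithinAt (fun z => ∑ i, ∑ j, |hessian f z i j - hessian f x i j|) s x :=
      tendsto_finsetSum _ fun i _ => tendsto_finsetSum _ fun j _ =>
        ((hc i j).sub tendsto_const_nhds).abs
    simpa [ContinuousWithinAt] using this
  refine tendsto_iff_dist_tendsto_zero.2 (squeeze_zero' (.of_forall fun _ => dist_nonneg) ?_ h0)
  filter_upwards [self_mem_nhdsWithin] with z hz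
  have hM := hessian_isHermitian hs hf hx
  have hN := hessian_isHermitian hs hf hz
  have h1 := eigenvalue_zero_le_add hM hN
  have h2 := eigenvalue_zero_le_add hN hM
  simp only [abs_sub_comm (hessian f x _ _)] at h2
  rw [Real.dist_eq, abs_le]
  constructor <;> linarith

theorem rayleigh_frame_le {M : Matrix (Fin n) (Fin n) ℝ} (hM : M.IsHermitian)
    (e : OrthonormalBasis (Fin n) ℝ (EuclideanSpace ℝ (Fin n))) (a : Fin n → ℝ) :
    ∑ i, ∑ j, a i * a j * ((frameMatrix e).transpose * M * frameMatrix e) i j ≤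
      eigenvalue M 0 * ∑ i, a i ^ 2 := by
  have h := dotProduct_mulVec_le hM (WithLp.toLp 2 ((frameMatrix e).mulVec a))
  have h1 : dotProduct ((frameMatrix e).mulVec a) (M.mulVec ((frameMatrix e).mulVec a)) =
      ∑ i, ∑ j, a i * a j * ((frameMatrix e).transpose * M * frameMatrix e) i j := by
    rw [Matrix.mulVec_mulVec, ← Matrix.vecMul_transpose, ← Matrix.dotProduct_mulVec,
      Matrix.mulVec_mulVec, ← mul_assoc]
    generalize (frameMatrix e).transpose * M * frameMatrix e = N
    simp only [dotProduct, Matrix.mulVec, Finset.mul_sum]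
    exact Finset.sum_congr rfl fun i _ => Finset.sum_congr rfl fun j _ => by ring
  have h2 : ‖(WithLp.toLp 2 ((frameMatrix e).mulVec a) : EuclideanSpace ℝ (Fin n))‖ ^ 2 =
      ∑ i, a i ^ 2 := by
    have : dotProduct ((frameMatrix e).mulVec a) ((frameMatrix e).mulVec a) = dotProduct a a := by
      rw [← Matrix.vecMul_transpose (frameMatrix e) a, ← Matrix.dotProduct_mulVec,
        Matrix.vecMul_transpose, Matrix.mulVec_mulVec, frameMatrix_transpose_mul, Matrix.one_mulVec]
    rw [EuclideanSpace.norm_sq_eq]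
    simpa [dotProduct, sq] using this
  rw [h2] at h
  simpa only [h1] using h

/-- Maximum principle: if `G (λ₁)` is touched from below by `W` at `x`, then `W` is
infinitesimally superharmonic at `x` for the linearized operator, as soon as the Jacobi
inequality for `G (λ₁)` holds at `x` along some choice of test directions `c`. -/
theorem sum_mul_le_zero_of_touching (hs : IsOpen s) (hf : ContDiffOn ℝ ∞ f s)
    (hx : x ∈ s)
    {e : OrthonormalBasis (Fin n) ℝ (EuclideanSpace ℝ (Fin n))} {l : Fin n → ℝ}
    (hl : l = eigenvalue (hessian f x))
    (he : ∀ i, (hessian f x).mulVec (e i) = l i • (e i : Fin n → ℝ))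
    {G G' : ℝ → ℝ} {G'' : ℝ} (hG : ∀ᶠ y in 𝓝 (l 0), HasDerivAt G (G' y) y)
    (hG' : HasDerivAt G' G'' (l 0)) {V : Set ℝ} (hV : V ∈ 𝓝 (l 0)) (hanti : AntitoneOn G V)
    {W : EuclideanSpace ℝ (Fin n) → ℝ} {W₀ W₁ W₂ : Fin n → ℝ}
    (hW : ∀ k, HasJet (fun t : ℝ => W (x + t • e k)) (W₀ k) (W₁ k) (W₂ k))
    (hle : ∀ᶠ z in 𝓝 x, W z ≤ G (eigenvalue (hessian f z) 0)) (heq : W x = G (l 0))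
    {c : Fin n → Fin n → ℝ} (hc : ∀ k, c k 0 = 0)
    (hJ : G' (l 0) * ∑ k, (1 + l k ^ 2)⁻¹ *
        (dirDeriv (e k) (dirDeriv (e k) (dirDeriv (e 0) (dirDeriv (e 0) f))) x +
          ∑ j, (4 * c k j * thirdDeriv f x e 0 j k - 2 * c k j ^ 2 * (l 0 - l j))) +
      G'' * ∑ k, (1 + l k ^ 2)⁻¹ * thirdDeriv f x e 0 0 k ^ 2 ≤ 0) :
    ∑ k, (1 + l k ^ 2)⁻¹ * W₂ k ≤ 0 := by
  have hk : ∀ k, W₂ k ≤ G'' * thirdDeriv f x e 0 0 k ^ 2 + G' (l 0) *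
      (dirDeriv (e k) (dirDeriv (e k) (dirDeriv (e 0) (dirDeriv (e 0) f))) x +
          ∑ j, (4 * c k j * thirdDeriv f x e 0 j k - 2 * c k j ^ 2 * (l 0 - l j))) := by
    intro k
    have hline := tendsto_line x (e k)
    have hlineS := hline.eventually (hs.mem_nhds hx)
    have hray := hasJet_rayleigh (l := l) (H₁ := fun i j => thirdDeriv f x e i j k)
      (H₂ := fun i j => dirDeriv (e k) (dirDeriv (e k) (dirDeriv (e i) (dirDeriv (e j) f))) x)
      (H := fun t => (frameMatrix e).transpose * hessian f (x + t • e k) * frameMatrix e)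
      (fun i j => thirdDeriv_swap₁₂ hs hf hx e i j k) (by
        intro i j
        have := hasJet_line (e k) hs (contDiffOn_dirDeriv (e i) hs
          (contDiffOn_dirDeriv (e j) hs hf)) hx
        rw [dirDeriv_dirDeriv_eigenframe hs hf hx he] at this
        refine this.congr ?_
        filter_upwards [hlineS] with t ht
        rw [dirDeriv_dirDeriv_frame hs hf ht]) (c k) (hc k)
    have hcomp := (hray.comp hG hG').sub (hW k)
    have hW0 : W₀ k = G (l 0) := by
      rw [← heq, ← (hW k).apply_zero]; simp
    rw [hW0, sub_self] at hcomp
    have hev : ContinuousAt (fun z => eigenvalue (hessian f z) 0) x :=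
      (continuousOn_eigenvalue_zero hs hf).continuousAt (hs.mem_nhds hx)
    have hV0 : V ∈ 𝓝 (eigenvalue (hessian f x) 0) := by rw [← hl]; exact hV
    have hV1 := hline.eventually (hev.eventually hV0)
    have hV2 := hray.tendsto.eventually hV
    -- Since `G` is decreasing and the Rayleigh quotient is at most `λ₁`, near the contact point `W
    -- ≤ G (λ₁) ≤ G (Rayleigh quotient)`, with equality at `t = 0`.
    have := hcomp.nonneg_of_isMin (by
      filter_upwards [hlineS, hV1, hV2, hline.eventually hle] with t ht h1 h2 h3
      refine sub_nonneg.2 (h3.trans (hanti h2 h1 ?_))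
      rw [← div_eq_mul_inv, div_le_iff₀]
      · exact rayleigh_frame_le (hessian_isHermitian hs hf ht) e _
      · refine Finset.sum_pos' (fun i _ => sq_nonneg _) ⟨0, Finset.mem_univ _, ?_⟩
        simp [hc])
    linarith
  calc ∑ k, (1 + l k ^ 2)⁻¹ * W₂ k ≤ _ := Finset.sum_le_sum fun k _ =>
        mul_le_mul_of_nonneg_left (hk k) (by positivity)
    _ = _ := by
      simp only [mul_add, Finset.sum_add_distrib, Finset.mul_sum]
      rw [add_comm]
      simp only [mul_left_comm]
    _ ≤ 0 := hJ

end MaximumPrinciple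

/-! ### Reduction of the Jacobi inequality to conditions on the eigenvalues. -/

section JacobiAlgebra

variable {n : ℕ} [NeZero n] {l : Fin n → ℝ} {T : Fin n → Fin n → Fin n → ℝ} {q : Fin n → ℝ}

theorem sum_diag_add_le_sum {F : Fin n → Fin n → ℝ}
    (hF : ∀ j k, j ≠ 0 → k ≠ 0 → j ≠ k → 0 ≤ F j k) :
    ∑ j, F j j + ∑ j, (if j = 0 then 0 else F 0 j + F j 0) ≤ ∑ j, ∑ k, F j k := by
  have h : ∀ j k, (if j = k then F j j else 0) + (if j = 0 then (if k = 0 then 0 else F 0 k) else 0)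
      + (if k = 0 then (if j = 0 then 0 else F j 0) else 0) ≤ F j k := by
    intro j k
    by_cases hj : j = 0 <;> by_cases hk : k = 0
    · subst hj hk; simp
    · subst hj; simp [hk, Ne.symm hk]
    · subst hk; simp [hj]
    · by_cases hjk : j = k
      · subst hjk; simp [hj]
      · simpa [hj, hk, hjk] using hF j k hj hk hjk
  refine le_trans (le_of_eq ?_)
    (Finset.sum_le_sum fun j (_ : j ∈ Finset.univ) =>
      Finset.sum_le_sum fun k (_ : k ∈ Finset.univ) => h j k)
  simp only [Finset.sum_add_distrib]
  rw [Finset.sum_comm (s := (Finset.univ : Finset (Fin n))) (t := (Finset.univ : Finset (Fin n)))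
    (f := fun j k => (if j = 0 then (if k = 0 then 0 else F 0 k) else 0 : ℝ))]
  simp only [Finset.sum_ite_eq, Finset.sum_ite_eq', Finset.mem_univ, if_true]
  simp only [← Finset.sum_add_distrib]
  refine Finset.sum_congr rfl fun j _ => ?_
  split_ifs <;> simp [add_assoc]

/-- With `Xᵢⱼ = gᵢ gⱼ Tᵢⱼ₀²`, where `gᵢ = (1 + lᵢ²)⁻¹`, and the optimal `c`, the right-hand side
becomes `Σ (lⱼ + lₖ + 2 mⱼ) Xⱼₖ` with `mⱼ = (1 + lⱼ²) / (l₀ - lⱼ)`. The terms with distinct nonzero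
indices are nonnegative and dropped. Those with exactly one index `0` are governed by `hoff`, and
the diagonal ones by `hdiag` applied to `yⱼ = gⱼ Tⱼⱼ₀`, whose sum vanishes by `h₁`. -/
theorem exists_test_directions (hl : ∀ j, l j ≤ l 0)
    (hT₁₂ : ∀ i j k, T i j k = T j i k) (hT₁₃ : ∀ i j k, T i j k = T k j i)
    (h₁ : ∑ i, (1 + l i ^ 2)⁻¹ * T i i 0 = 0)
    (h₂ : ∑ i, (1 + l i ^ 2)⁻¹ * q i =
      ∑ i, ∑ j, (l i + l j) * (1 + l i ^ 2)⁻¹ * (1 + l j ^ 2)⁻¹ * T i j 0 ^ 2)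
    (hpos : ∀ i j, i ≠ j → 0 ≤ l i + l j) {R : ℝ}
    (hoff : ∀ j, l j < l 0 → R * (l 0 - l j) ≤ 2)
    (hdiag : ∀ y : Fin n → ℝ, ∑ j, y j = 0 → (∀ j, j ≠ 0 → l j = l 0 → y j = 0) →
      R * (1 + l 0 ^ 2) * y 0 ^ 2 ≤ 2 * l 0 * y 0 ^ 2 +
        ∑ j, if j = 0 then 0 else 2 * ((1 + l 0 * l j) / (l 0 - l j)) * y j ^ 2) :
    ∃ c : Fin n → Fin n → ℝ, (∀ k, c k 0 = 0) ∧
      R * ∑ k, (1 + l k ^ 2)⁻¹ * T 0 0 k ^ 2 ≤ ∑ k, (1 + l k ^ 2)⁻¹ *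
        (q k + ∑ j, (4 * c k j * T 0 j k - 2 * c k j ^ 2 * (l 0 - l j))) := by
  -- If `λ₁` is multiple and some `T 0 j k` couples `e₀` to another vector of its eigenspace, the
  -- term linear in `c` has no quadratic penalty there, so the right-hand side can be given any
  -- value; `t` below is tuned to give equality.
  by_cases hdeg : ∃ j k, j ≠ 0 ∧ l j = l 0 ∧ T 0 j k ≠ 0
  · obtain ⟨j₀, k₀, hj0, hlj, hT⟩ := hdeg
    set b : Fin n → Fin n → ℝ := fun k j => if j ≠ 0 ∧ l j = l 0 then T 0 j k else 0 with hb
    have hbT : ∀ k j, b k j * T 0 j k = b k j ^ 2 := by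
      intro k j
      simp only [hb]
      split_ifs <;> ring
    have hbl : ∀ k j, b k j ^ 2 * (l 0 - l j) = 0 := by
      intro k j
      simp only [hb]
      split_ifs with h
      · rw [h.2]; ring
      · ring
    set B := ∑ k, (1 + l k ^ 2)⁻¹ * ∑ j, b k j ^ 2 with hB
    have hBpos : 0 < B := by
      refine Finset.sum_pos' (fun k _ => by positivity) ⟨k₀, Finset.mem_univ _, ?_⟩
      refine mul_pos (by positivity)
        (Finset.sum_pos' (fun j _ => sq_nonneg _) ⟨j₀, Finset.mem_univ _, ?_⟩)
      simp only [hb, if_pos (And.intro hj0 hlj)]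
      positivity
    set t := (R * ∑ k, (1 + l k ^ 2)⁻¹ * T 0 0 k ^ 2 - ∑ k, (1 + l k ^ 2)⁻¹ * q k) / (4 * B)
      with ht
    refine ⟨fun k j => t * b k j, fun k => by simp [hb], le_of_eq ?_⟩
    have e1 : ∀ k j, 4 * (t * b k j) * T 0 j k - 2 * (t * b k j) ^ 2 * (l 0 - l j) =
        4 * t * b k j ^ 2 := by
      intro k j
      linear_combination 4 * t * hbT k j - 2 * t ^ 2 * hbl k j
    simp only [e1, ← Finset.mul_sum, mul_add, Finset.sum_add_distrib]
    have e2 : ∑ k, (1 + l k ^ 2)⁻¹ * (4 * t * ∑ j, b k j ^ 2) = 4 * t * B := by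
      rw [hB, Finset.mul_sum]
      exact Finset.sum_congr rfl fun k _ => by ring
    rw [e2, ht]
    field_simp
    ring
  · push Not at hdeg
    -- This is the first-order perturbation of the top eigenvector, the maximizer of `4 c T - 2 c²
    -- (l₀ - lⱼ)`. When `l j = l 0` the numerator is zero as well, and the quotient is read as `0`.
    refine ⟨fun k j => if j = 0 then 0 else T 0 j k / (l 0 - l j), fun k => by simp, ?_⟩
    set g : Fin n → ℝ := fun i => (1 + l i ^ 2)⁻¹ with hg
    have hgpos : ∀ i, 0 < g i := fun i => by simp only [hg]; positivity
    have hgi : ∀ i, (1 + l i ^ 2) * g i = 1 := fun i => by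
      simp only [hg]; exact mul_inv_cancel₀ (by positivity)
    set X : Fin n → Fin n → ℝ := fun i j => g i * g j * T i j 0 ^ 2 with hX
    have hXnn : ∀ i j, 0 ≤ X i j := fun i j =>
      mul_nonneg (mul_nonneg (hgpos i).le (hgpos j).le) (sq_nonneg _)
    have hXs : ∀ i j, X i j = X j i := fun i j => by
      simp only [hX, hT₁₂ i j 0]; ring
    have hTc : ∀ j k, T 0 j k = T j k 0 := fun j k => by rw [hT₁₃, hT₁₂]
    have hTX : ∀ j k, g k * T 0 j k ^ 2 = (1 + l j ^ 2) * X j k := fun j k => by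
      simp only [hX, hTc]
      linear_combination (-(g k * T j k 0 ^ 2)) * hgi j
    set m : Fin n → ℝ := fun j => if j = 0 then 0 else (1 + l j ^ 2) / (l 0 - l j) with hm
    have hm0 : m 0 = 0 := by simp [hm]
    have hmnn : ∀ j, 0 ≤ m j := fun j => by
      simp only [hm]
      split_ifs
      · exact le_rfl
      · exact div_nonneg (by positivity) (sub_nonneg.2 (hl j))
    have hXdeg : ∀ j k, j ≠ 0 → l j = l 0 → X j k = 0 := fun j k hj hlj => by
      have := hdeg j k hj hlj
      rw [hTc] at this
      simp [hX, this]
    have hR : ∑ k, g k * (q k + ∑ j, (4 * (if j = 0 then 0 else T 0 j k / (l 0 - l j)) * T 0 j k -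
        2 * (if j = 0 then 0 else T 0 j k / (l 0 - l j)) ^ 2 * (l 0 - l j))) =
        ∑ j, ∑ k, (l j + l k + 2 * m j) * X j k := by
      have eR : ∀ j k, (l j + l k + 2 * m j) * X j k = (l j + l k) * X j k + 2 * m j * X j k :=
        fun j k => by ring
      simp only [mul_add (g _), eR, Finset.sum_add_distrib]
      rw [h₂]
      simp only [Finset.mul_sum]
      congr 1
      · exact Finset.sum_congr rfl fun j _ => Finset.sum_congr rfl fun k _ => by
          simp only [hX]; ring
      · rw [Finset.sum_comm]
        refine Finset.sum_congr rfl fun j _ => Finset.sum_congr rfl fun k _ => ?_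
        by_cases hj : j = 0
        · simp [hj, hm0]
        · simp only [hj, if_false, hm]
          by_cases hlj : l j = l 0
          · simp [hlj]
          · have : l 0 - l j ≠ 0 := sub_ne_zero.2 (Ne.symm hlj)
            have e1 : g k * (4 * (T 0 j k / (l 0 - l j)) * T 0 j k -
                2 * (T 0 j k / (l 0 - l j)) ^ 2 * (l 0 - l j)) =
                2 / (l 0 - l j) * (g k * T 0 j k ^ 2) := by
              field_simp
              ring
            rw [e1, hTX]
            ring
    rw [hR]
    have hL : R * ∑ k, g k * T 0 0 k ^ 2 = R * (1 + l 0 ^ 2) * X 0 0 +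
        ∑ j, if j = 0 then 0 else R * (1 + l 0 ^ 2) * X 0 j := by
      simp only [hTX, Finset.mul_sum]
      rw [Finset.sum_eq_add_sum_sdiff_singleton_of_mem (Finset.mem_univ (0 : Fin n)),
        Finset.sum_eq_add_sum_sdiff_singleton_of_mem (Finset.mem_univ (0 : Fin n))
          (f := fun j => if j = 0 then 0 else R * (1 + l 0 ^ 2) * X 0 j)]
      simp only [if_true, zero_add]
      congr 1
      · ring
      · refine Finset.sum_congr rfl fun j hj => ?_
        have : j ≠ 0 := by simpa using hj
        simp only [this, if_false]
        ring
    rw [hL]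
    refine le_trans ?_ (sum_diag_add_le_sum fun j k _ _ hjk =>
      mul_nonneg (add_nonneg (hpos j k hjk) (mul_nonneg zero_le_two (hmnn j))) (hXnn j k))
    refine add_le_add ?_ (Finset.sum_le_sum fun j _ => ?_)
    · have hy := hdiag (fun j => g j * T j j 0) h₁ (fun j hj hlj => by
        have := hXdeg j j hj hlj
        have h3 : (g j * T j j 0) ^ 2 = 0 := by rw [← this]; simp only [hX]; ring
        exact pow_eq_zero_iff two_ne_zero |>.1 h3)
      have hXy : ∀ j, X j j = (g j * T j j 0) ^ 2 := fun j => by simp only [hX]; ring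
      rw [hXy 0]
      refine hy.trans (le_of_eq ?_)
      rw [Finset.sum_eq_add_sum_sdiff_singleton_of_mem (Finset.mem_univ (0 : Fin n)),
        Finset.sum_eq_add_sum_sdiff_singleton_of_mem (Finset.mem_univ (0 : Fin n))
          (f := fun j => (l j + l j + 2 * m j) * X j j)]
      simp only [if_true, zero_add, hm0]
      congr 1
      · rw [hXy]; ring
      · refine Finset.sum_congr rfl fun j hj => ?_
        have hj : j ≠ 0 := by simpa using hj
        simp only [hj, if_false, hm]
        by_cases hlj : l j = l 0
        · rw [← hXy, hXdeg j j hj hlj]; ring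
        · have : l 0 - l j ≠ 0 := sub_ne_zero.2 (Ne.symm hlj)
          rw [← hXy]
          field_simp
          ring
    · split_ifs with hj
      · exact le_rfl
      · rw [hXs j 0, ← add_mul, hm0]
        by_cases hlj : l j = l 0
        · rw [hXs, hXdeg j 0 hj hlj]; simp
        · refine mul_le_mul_of_nonneg_right ?_ (hXnn _ _)
          have hlt : l j < l 0 := lt_of_le_of_ne (hl j) hlj
          have hd : 0 < l 0 - l j := sub_pos.2 hlt
          have e : l 0 + l j + 2 * 0 + (l j + l 0 + 2 * m j) =
              2 / (l 0 - l j) * (1 + l 0 ^ 2) := by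
            simp only [hm, hj, if_false]
            field_simp
            ring
          rw [e]
          refine mul_le_mul_of_nonneg_right ?_ (by positivity)
          rw [le_div_iff₀ hd]
          exact hoff j hlt

end JacobiAlgebra


/-! ### Consequences of `Θ ≥ (n - 2) π / 2` for the eigenvalues. -/

section Phase

theorem arctan_add_le {a b : ℝ} (ha : 0 ≤ a) (hb : 0 ≤ b) :
    Real.arctan (a + b) ≤ Real.arctan a + Real.arctan b := by
  by_cases h : a * b < 1
  · rw [Real.arctan_add h]
    refine Real.arctan_mono ?_
    rw [le_div_iff₀ (by linarith)]
    nlinarith [mul_nonneg ha hb]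
  · push Not at h
    have ha' : 0 < a := lt_of_le_of_ne ha (by rintro rfl; norm_num at h)
    have h1 : a⁻¹ ≤ b := by rw [inv_le_iff_one_le_mul₀ ha']; linarith
    have h2 := Real.arctan_mono h1
    rw [Real.arctan_inv_of_pos ha'] at h2
    linarith [Real.arctan_lt_pi_div_two (a + b)]

theorem arctan_sum_le {ι : Type*} (s : Finset ι) {a : ι → ℝ} (ha : ∀ i ∈ s, 0 ≤ a i) :
    Real.arctan (∑ i ∈ s, a i) ≤ ∑ i ∈ s, Real.arctan (a i) := by
  classical
  induction s using Finset.induction_on with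
  | empty => simp
  | insert i s hi ih =>
    rw [Finset.sum_insert hi, Finset.sum_insert hi]
    have h1 := ih fun j hj => ha j (Finset.mem_insert_of_mem hj)
    have h2 := arctan_add_le (ha i (Finset.mem_insert_self i s))
      (Finset.sum_nonneg fun j hj => ha j (Finset.mem_insert_of_mem hj))
    linarith

variable {n : ℕ} {l : Fin n → ℝ} {Θ : ℝ}

/-- The other `n - 2` arctangents contribute at most `(n - 2) π / 2`, so the two remaining ones have
a nonnegative sum. In particular at most one eigenvalue is negative. -/
theorem add_nonneg_of_phase (hΘ : ((n : ℝ) - 2) * Real.pi / 2 ≤ Θ)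
    (hl : ∑ i, Real.arctan (l i) = Θ) {i j : Fin n} (hij : i ≠ j) : 0 ≤ l i + l j := by
  have h1 := Finset.sum_erase_add _ (fun i => Real.arctan (l i)) (Finset.mem_univ i)
  have h2 := Finset.sum_erase_add _ (fun i => Real.arctan (l i))
    (Finset.mem_erase.2 ⟨hij.symm, Finset.mem_univ j⟩)
  have h3 : ∑ k ∈ (Finset.univ.erase i).erase j, Real.arctan (l k) ≤
      ∑ k ∈ (Finset.univ.erase i).erase j, Real.pi / 2 :=
    Finset.sum_le_sum fun k _ => (Real.arctan_lt_pi_div_two _).le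
  have hcard : ((Finset.univ.erase i).erase j).card + 2 = n := by
    have e1 := Finset.card_erase_add_one (Finset.mem_univ i)
    have e2 := Finset.card_erase_add_one (Finset.mem_erase.2 ⟨hij.symm, Finset.mem_univ j⟩)
    simp only [Finset.card_univ, Fintype.card_fin] at e1
    omega
  have hcard' : (((Finset.univ.erase i).erase j).card : ℝ) = n - 2 := by
    rw [eq_sub_iff_add_eq]; exact_mod_cast hcard
  rw [Finset.sum_const, nsmul_eq_mul, hcard'] at h3
  have h4 : Real.arctan (-l j) ≤ Real.arctan (l i) := by
    rw [Real.arctan_neg]; linarith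
  have := Real.arctan_strictMono.le_iff_le.1 h4
  linarith

/-- By subadditivity of `arctan` on `[0, ∞)`, the arctangent of the left side is at most `Σ (π / 2 -
arctan lᵢ)`. The phase bound makes this at most `π / 2 + arctan lⱼ = arctan (1 / (-lⱼ))`. -/
theorem sum_inv_le_of_phase (hΘ : ((n : ℝ) - 2) * Real.pi / 2 ≤ Θ)
    (hl : ∑ i, Real.arctan (l i) = Θ) {j : Fin n} (hj : l j < 0) :
    ∑ i ∈ Finset.univ.erase j, (l i)⁻¹ ≤ (-l j)⁻¹ := by
  have hpos : ∀ i ∈ Finset.univ.erase j, 0 < l i := fun i hi => by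
    have := add_nonneg_of_phase hΘ hl (Finset.ne_of_mem_erase hi)
    linarith
  rw [← Real.arctan_strictMono.le_iff_le]
  refine (arctan_sum_le _ fun i hi => (inv_pos.2 (hpos i hi)).le).trans ?_
  have h1 : ∑ i ∈ Finset.univ.erase j, Real.arctan (l i)⁻¹ =
      ∑ i ∈ Finset.univ.erase j, (Real.pi / 2 - Real.arctan (l i)) :=
    Finset.sum_congr rfl fun i hi => Real.arctan_inv_of_pos (hpos i hi)
  have h2 := Finset.sum_erase_add _ (fun i => Real.arctan (l i)) (Finset.mem_univ j)
  have hcard : ((Finset.univ.erase j).card : ℝ) = n - 1 := by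
    have e1 := Finset.card_erase_add_one (Finset.mem_univ j)
    simp only [Finset.card_univ, Fintype.card_fin] at e1
    rw [eq_sub_iff_add_eq]; exact_mod_cast e1
  rw [h1, Real.arctan_inv_of_pos (by linarith), Real.arctan_neg, Finset.sum_sub_distrib,
    Finset.sum_const, nsmul_eq_mul, hcard]
  linarith

end Phase

/-! ### Functions of `λ₁` satisfying the Jacobi inequality. -/

section Jacobi

variable {n : ℕ} [NeZero n]

/-- Pointwise conditions on the eigenvalues `l` of the Hessian and on a decreasing function `G`
under which `G (λ₁)` satisfies the Jacobi inequality (is superharmonic) at a point. -/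
def JacobiAt (G : ℝ → ℝ) (l : Fin n → ℝ) : Prop :=
  ∃ (G' : ℝ → ℝ) (G'' R : ℝ) (V : Set ℝ), (∀ᶠ y in 𝓝 (l 0), HasDerivAt G (G' y) y) ∧
    HasDerivAt G' G'' (l 0) ∧ V ∈ 𝓝 (l 0) ∧ AntitoneOn G V ∧ G' (l 0) ≤ 0 ∧
    G' (l 0) * R + G'' ≤ 0 ∧ (∀ j, l j < l 0 → R * (l 0 - l j) ≤ 2) ∧
    ∀ y : Fin n → ℝ, ∑ j, y j = 0 → (∀ j, j ≠ 0 → l j = l 0 → y j = 0) →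
      R * (1 + l 0 ^ 2) * y 0 ^ 2 ≤ 2 * l 0 * y 0 ^ 2 +
        ∑ j, if j = 0 then 0 else 2 * ((1 + l 0 * l j) / (l 0 - l j)) * y j ^ 2

theorem sum_mul_le_zero_of_jacobiAt {s : Set (EuclideanSpace ℝ (Fin n))}
    {f : EuclideanSpace ℝ (Fin n) → ℝ} {x : EuclideanSpace ℝ (Fin n)} {Θ : ℝ}
    (hΘ : ((n : ℝ) - 2) * Real.pi / 2 ≤ Θ)
    (hs : IsOpen s) (hf : ContDiffOn ℝ ∞ f s) (hsol : IsSolutionOn Θ f s) (hx : x ∈ s)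
    {e : OrthonormalBasis (Fin n) ℝ (EuclideanSpace ℝ (Fin n))} {l : Fin n → ℝ}
    (hl : l = eigenvalue (hessian f x))
    (he : ∀ i, (hessian f x).mulVec (e i) = l i • (e i : Fin n → ℝ))
    {G : ℝ → ℝ} (hG : JacobiAt G l)
    {W : EuclideanSpace ℝ (Fin n) → ℝ} {W₀ W₁ W₂ : Fin n → ℝ}
    (hW : ∀ k, HasJet (fun t : ℝ => W (x + t • e k)) (W₀ k) (W₁ k) (W₂ k))
    (hle : ∀ᶠ z in 𝓝 x, W z ≤ G (eigenvalue (hessian f z) 0)) (heq : W x = G (l 0)) :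
    ∑ k, (1 + l k ^ 2)⁻¹ * W₂ k ≤ 0 := by
  obtain ⟨G', G'', R, V, h1, h2, hV, hanti, hneg, hR, hoff, hdiag⟩ := hG
  have hphase : ∑ i, Real.arctan (l i) = Θ := by rw [hl]; exact hsol x hx
  have hvar := equation_variation_frame hs hf hsol hx he 0
  obtain ⟨c, hc, hJ⟩ := exists_test_directions (T := thirdDeriv f x e)
    (q := fun k => dirDeriv (e k) (dirDeriv (e k) (dirDeriv (e 0) (dirDeriv (e 0) f))) x)
    (fun j => by rw [hl]; exact eigenvalue_antitone _ (Fin.zero_le j))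
    (thirdDeriv_swap₁₂ hs hf hx e) (thirdDeriv_swap₁₃ hs hf hx e) hvar.1 hvar.2
    (fun i j hij => add_nonneg_of_phase hΘ hphase hij) hoff hdiag
  refine sum_mul_le_zero_of_touching hs hf hx hl he h1 h2 hV hanti hW hle heq hc ?_
  have hD : 0 ≤ ∑ k, (1 + l k ^ 2)⁻¹ * thirdDeriv f x e 0 0 k ^ 2 :=
    Finset.sum_nonneg fun k _ => by positivity
  nlinarith [mul_le_mul_of_nonpos_left hJ hneg, mul_le_mul_of_nonneg_right hR hD]

variable {l : Fin n → ℝ} {Θ : ℝ}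

/-- In dimension two `y₁ = -y₀`, and by this identity the diagonal condition is then the
off-diagonal one multiplied by `(1 + l₀²) y₀²`. -/
theorem one_add_mul_div_sub (a b : ℝ) (h : b < a) :
    2 * a + 2 * ((1 + a * b) / (a - b)) = 2 * (1 + a ^ 2) / (a - b) := by
  have : a - b ≠ 0 := by linarith
  field_simp
  ring

/-- The largest eigenvalue dominates: `λ₁ - λⱼ ≤ n / (n - 1) λ₁`. -/
theorem sub_le_of_phase (hΘ : ((n : ℝ) - 2) * Real.pi / 2 ≤ Θ)
    (hlΘ : ∑ i, Real.arctan (l i) = Θ) (hl : ∀ j, l j ≤ l 0) (h0 : 0 < l 0) (j : Fin n) :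
    ((n : ℝ) - 1) * (l 0 - l j) ≤ n * l 0 := by
  have hn : (1 : ℝ) ≤ n := by exact_mod_cast Nat.one_le_iff_ne_zero.2 (NeZero.ne n)
  by_cases hj : l j < 0
  · have hinv := sum_inv_le_of_phase hΘ hlΘ hj
    have h1 : ∑ i ∈ Finset.univ.erase j, (l 0)⁻¹ ≤ ∑ i ∈ Finset.univ.erase j, (l i)⁻¹ :=
      Finset.sum_le_sum fun i hi => by
        have := add_nonneg_of_phase hΘ hlΘ (Finset.ne_of_mem_erase hi)
        exact inv_anti₀ (by linarith) (hl i)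
    have hcard : ((Finset.univ.erase j).card : ℝ) = n - 1 := by
      have e1 := Finset.card_erase_add_one (Finset.mem_univ j)
      simp only [Finset.card_univ, Fintype.card_fin] at e1
      rw [eq_sub_iff_add_eq]; exact_mod_cast e1
    rw [Finset.sum_const, nsmul_eq_mul, hcard] at h1
    have h2 := h1.trans hinv
    rw [← div_eq_mul_inv, ← one_div, div_le_div_iff₀ h0 (by linarith)] at h2
    linarith
  · push Not at hj
    nlinarith

/-- The quadratic form inequality behind the Jacobi inequality. -/
theorem diag_inequality (hn : 2 ≤ n) (hΘ : ((n : ℝ) - 2) * Real.pi / 2 ≤ Θ)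
    (hlΘ : ∑ i, Real.arctan (l i) = Θ) (hl : ∀ j, l j ≤ l 0) (h0 : 0 < l 0) {y : Fin n → ℝ}
    (hy : ∑ j, y j = 0) (hdeg : ∀ j, j ≠ 0 → l j = l 0 → y j = 0) :
    0 ≤ 2 / n * l 0 * y 0 ^ 2 +
      ∑ j, if j = 0 then 0 else 2 * ((1 + l 0 * l j) / (l 0 - l j)) * y j ^ 2 := by
  have hn' : (0 : ℝ) < n := by exact_mod_cast (by omega : 0 < n)
  -- If no eigenvalue is negative, every term is nonnegative. Otherwise exactly one term can be
  -- negative, and it is absorbed by the others through `y k = -Σ_{j ≠ k} y j` and a weighted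
  -- Cauchy–Schwarz inequality.
  by_cases hneg : ∃ k, l k < 0
  · obtain ⟨k, hk⟩ := hneg
    have hk0 : k ≠ 0 := by rintro rfl; linarith
    set t := (Finset.univ.erase (0 : Fin n)).erase k with ht
    have hpos : ∀ j, j ≠ k → 0 < l j := fun j hj => by
      have := add_nonneg_of_phase hΘ hlΘ hj
      linarith
    have hsplit : ∀ F : Fin n → ℝ, ∑ j, F j = F 0 + F k + ∑ j ∈ t, F j := fun F => by
      rw [← Finset.add_sum_erase _ F (Finset.mem_univ (0 : Fin n)),
        ← Finset.add_sum_erase _ F (Finset.mem_erase.2 ⟨hk0, Finset.mem_univ k⟩)]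
      ring
    have htmem : ∀ j ∈ t, j ≠ 0 ∧ j ≠ k := fun j hj => by
      simp only [ht, Finset.mem_erase, Finset.mem_univ, and_true] at hj
      exact ⟨hj.2, hj.1⟩
    set A := y 0 ^ 2 / n + ∑ j ∈ t, y j ^ 2 * (l j / (l 0 - l j)) with hA
    have hdiff : 0 < l 0 - l k := by linarith
    -- Sum of the inverse weights. As `t` has `n - 2` elements, the left side is `2 + l₀ Σ_t 1 /
    -- lⱼ`, and the claim is `sum_inv_le_of_phase` multiplied by `l₀`; this fixes the weight `1 / n`
    -- of `y 0 ^ 2`.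
    have hB : (n : ℝ) + ∑ j ∈ t, (l 0 - l j) / l j ≤ (l 0 - l k) / (-l k) := by
      have e1 : ∑ j ∈ t, (l 0 - l j) / l j = l 0 * ∑ j ∈ t, (l j)⁻¹ - t.card := by
        rw [Finset.mul_sum, Finset.card_eq_sum_ones, Nat.cast_sum, ← Finset.sum_sub_distrib]
        refine Finset.sum_congr rfl fun j hj => ?_
        have := (hpos j (htmem j hj).2).ne'
        field_simp
        simp
      have e2 : (t.card : ℝ) = n - 2 := by
        have c1 := Finset.card_erase_add_one (Finset.mem_univ (0 : Fin n))
        have c2 : t.card + 1 = _ :=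
          Finset.card_erase_add_one (Finset.mem_erase.2 ⟨hk0, Finset.mem_univ k⟩)
        simp only [Finset.card_univ, Fintype.card_fin] at c1
        rw [eq_sub_iff_add_eq]
        exact_mod_cast (by omega : t.card + 2 = n)
      have e3 := sum_inv_le_of_phase hΘ hlΘ hk
      rw [← Finset.add_sum_erase _ _ (Finset.mem_erase.2 ⟨hk0.symm, Finset.mem_univ (0 : Fin n)⟩),
        Finset.erase_right_comm, ← ht] at e3
      have e4 : l 0 * ((l 0)⁻¹ + ∑ j ∈ t, (l j)⁻¹) ≤ l 0 * (-l k)⁻¹ :=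
        mul_le_mul_of_nonneg_left e3 h0.le
      rw [mul_add, mul_inv_cancel₀ h0.ne'] at e4
      have e5 : (l 0 - l k) / (-l k) = l 0 * (-l k)⁻¹ + 1 := by
        have : l k ≠ 0 := hk.ne
        field_simp
        ring
      rw [e1, e2, e5]
      linarith
    have hA0 : 0 ≤ A := by
      refine add_nonneg (by positivity) (Finset.sum_nonneg fun j hj => ?_)
      exact mul_nonneg (sq_nonneg _) (div_nonneg (hpos j (htmem j hj).2).le
        (sub_nonneg.2 (hl j)))
    have hCS : y k ^ 2 ≤ A * ((l 0 - l k) / (-l k)) := by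
      have hyk : (∑ j ∈ Finset.univ.erase k, y j) ^ 2 ≤
          (∑ j ∈ Finset.univ.erase k, if j = 0 then y 0 ^ 2 / n else
            y j ^ 2 * (l j / (l 0 - l j))) *
          (∑ j ∈ Finset.univ.erase k, if j = 0 then (n : ℝ) else (l 0 - l j) / l j) := by
        refine Finset.sum_sq_le_sum_mul_sum_of_sq_le_mul _ (fun j hj => ?_) (fun j hj => ?_)
          (fun j hj => ?_)
        · split_ifs
          · positivity
          · exact mul_nonneg (sq_nonneg _) (div_nonneg (hpos j (Finset.ne_of_mem_erase hj)).le
              (sub_nonneg.2 (hl j)))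
        · split_ifs
          · positivity
          · exact div_nonneg (sub_nonneg.2 (hl j)) (hpos j (Finset.ne_of_mem_erase hj)).le
        · refine le_of_eq ?_
          split_ifs with hj0
          · rw [hj0]; field_simp
          · by_cases hlj : l j = l 0
            · simp [hdeg j hj0 hlj]
            · have h1 : l 0 - l j ≠ 0 := sub_ne_zero.2 (Ne.symm hlj)
              have h2 := (hpos j (Finset.ne_of_mem_erase hj)).ne'
              field_simp
      have hs1 : ∀ F : Fin n → ℝ, ∑ j ∈ Finset.univ.erase k, F j = F 0 + ∑ j ∈ t, F j :=
        fun F => by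
          rw [ht, Finset.erase_right_comm]
          exact (Finset.add_sum_erase _ _
            (Finset.mem_erase.2 ⟨hk0.symm, Finset.mem_univ (0 : Fin n)⟩)).symm
      have hs2 : ∀ (a : ℝ) (F : Fin n → ℝ), ∑ j ∈ t, (if j = 0 then a else F j) =
          ∑ j ∈ t, F j := fun a F => Finset.sum_congr rfl fun j hj => by
        simp [(htmem j hj).1]
      have hsum : ∑ j ∈ Finset.univ.erase k, y j = -y k := by
        have := Finset.sum_erase_add _ y (Finset.mem_univ k)
        linarith
      rw [hsum, hs1 (fun j => if j = 0 then y 0 ^ 2 / n else _), hs1 (fun j => if j = 0 then _ else _),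
        hs2, hs2, if_pos rfl, if_pos rfl, neg_sq] at hyk
      exact hyk.trans (mul_le_mul_of_nonneg_left hB hA0)
    rw [hsplit]
    simp only [if_true, hk0, if_false, zero_add]
    have hk1 : -(2 * l 0 * A) ≤ 2 * ((1 + l 0 * l k) / (l 0 - l k)) * y k ^ 2 := by
      have h1 : l 0 * l k / (l 0 - l k) ≤ (1 + l 0 * l k) / (l 0 - l k) :=
        div_le_div_of_nonneg_right (by linarith) hdiff.le
      have h2 : l 0 * l k / (l 0 - l k) * y k ^ 2 = -(l 0 * (y k ^ 2 / ((l 0 - l k) / (-l k)))) := by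
        field_simp
      have h3 : y k ^ 2 / ((l 0 - l k) / (-l k)) ≤ A := by
        rw [div_le_iff₀ (div_pos hdiff (by linarith))]
        exact hCS
      nlinarith [mul_le_mul_of_nonneg_left h3 h0.le,
        mul_le_mul_of_nonneg_right h1 (sq_nonneg (y k))]
    have ht1 : ∑ j ∈ t, 2 * l 0 * (y j ^ 2 * (l j / (l 0 - l j))) ≤
        ∑ j ∈ t, if j = 0 then 0 else 2 * ((1 + l 0 * l j) / (l 0 - l j)) * y j ^ 2 := by
      refine Finset.sum_le_sum fun j hj => ?_
      rw [if_neg (htmem j hj).1]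
      have h1 : l 0 * l j / (l 0 - l j) ≤ (1 + l 0 * l j) / (l 0 - l j) :=
        div_le_div_of_nonneg_right (by linarith) (sub_nonneg.2 (hl j))
      calc _ = 2 * (l 0 * l j / (l 0 - l j)) * y j ^ 2 := by ring
        _ ≤ _ := by gcongr
    rw [← Finset.mul_sum] at ht1
    have : 2 * l 0 * A = 2 / n * l 0 * y 0 ^ 2 +
        2 * l 0 * ∑ j ∈ t, y j ^ 2 * (l j / (l 0 - l j)) := by
      rw [hA]; ring
    linarith
  · push Not at hneg
    refine add_nonneg (by positivity) (Finset.sum_nonneg fun j _ => ?_)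
    split_ifs
    · exact le_rfl
    · have : 0 ≤ (1 + l 0 * l j) / (l 0 - l j) :=
        div_nonneg (by nlinarith [mul_nonneg h0.le (hneg j)]) (sub_nonneg.2 (hl j))
      positivity

/-- Here `R` solves `G' R + G'' = 0`. It satisfies `R ≤ (1 + ε) / a` and `R (1 + a²) ≤ (1 + ε) a`,
so both remaining conditions need only `1 + ε ≤ 2 - 2 / n`. -/
theorem jacobiAt_exp (hn : 2 ≤ n) (hΘ : ((n : ℝ) - 2) * Real.pi / 2 ≤ Θ)
    (hlΘ : ∑ i, Real.arctan (l i) = Θ) (hl : ∀ j, l j ≤ l 0) (h0 : 0 < l 0) {ε : ℝ}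
    (hε0 : 0 ≤ ε) (hε : ε ≤ 1 - 2 / n) :
    JacobiAt (fun y => Real.exp (-(ε / 2 * Real.log (1 + y ^ 2)))) l := by
  set G : ℝ → ℝ := fun y => Real.exp (-(ε / 2 * Real.log (1 + y ^ 2))) with hGdef
  have hn' : (2 : ℝ) ≤ n := by exact_mod_cast hn
  set a := l 0 with ha
  have hG : ∀ y, HasDerivAt G (G y * (-(ε * (y / (1 + y ^ 2))))) y := fun y => by
    have h1 : HasDerivAt (fun y : ℝ => 1 + y ^ 2) (2 * y) y := by
      simpa using (hasDerivAt_pow 2 y).const_add 1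
    have h2 := ((h1.log (by positivity)).const_mul (ε / 2)).neg.exp
    convert! h2 using 1
    simp only [hGdef, Pi.neg_apply]
    field_simp
  have hq : HasDerivAt (fun y : ℝ => y / (1 + y ^ 2)) ((1 - a ^ 2) / (1 + a ^ 2) ^ 2) a := by
    have h1 : HasDerivAt (fun y : ℝ => 1 + y ^ 2) (2 * a) a := by
      simpa using (hasDerivAt_pow 2 a).const_add 1
    convert! (hasDerivAt_id a).div h1 (by positivity) using 1
    simp only [id]
    ring
  have hG' : HasDerivAt (fun y => G y * (-(ε * (y / (1 + y ^ 2)))))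
      (G a * (-(ε * (a / (1 + a ^ 2)))) * (-(ε * (a / (1 + a ^ 2)))) +
        G a * (-(ε * ((1 - a ^ 2) / (1 + a ^ 2) ^ 2)))) a :=
    (hG a).mul ((hq.const_mul ε).neg)
  have hGpos : 0 < G a := Real.exp_pos _
  refine ⟨fun y => G y * (-(ε * (y / (1 + y ^ 2)))), _,
    ((1 + ε) * a ^ 2 - 1) / (a * (1 + a ^ 2)), Set.Ioi 0, .of_forall hG, hG', Ioi_mem_nhds h0,
    ?_, ?_, le_of_eq ?_, ?_, ?_⟩
  · intro y hy z hz hyz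
    simp only [Set.mem_Ioi] at hy hz
    refine Real.exp_le_exp.2 (neg_le_neg (mul_le_mul_of_nonneg_left ?_ (by positivity)))
    exact Real.log_le_log (by positivity) (by nlinarith)
  · rw [← ha]
    exact mul_nonpos_of_nonneg_of_nonpos hGpos.le (neg_nonpos.2 (by positivity))
  · rw [← ha]
    field_simp
    ring
  · intro j hj
    rw [← ha] at hj ⊢
    have h1 := sub_le_of_phase hΘ hlΘ hl h0 j
    rw [← ha] at h1
    have hd : 0 < a - l j := by linarith
    have h2 : ((1 + ε) * a ^ 2 - 1) / (a * (1 + a ^ 2)) ≤ (1 + ε) / a := by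
      rw [div_le_div_iff₀ (by positivity) h0]
      nlinarith [mul_pos h0 h0]
    refine (mul_le_mul_of_nonneg_right h2 hd.le).trans ?_
    rw [div_mul_eq_mul_div, div_le_iff₀ h0]
    have h3 : (1 + ε) * n ≤ 2 * (n - 1) := by
      have : (1 + ε) * n ≤ (2 - 2 / n) * n := by nlinarith
      have e : (2 - 2 / (n : ℝ)) * n = 2 * (n - 1) := by field_simp
      linarith
    have h4 : (1 + ε) * (n * (a - l j)) ≤ 2 * (n * a) := by
      calc (1 + ε) * (n * (a - l j)) = ((1 + ε) * n) * (a - l j) := by ring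
        _ ≤ (2 * (n - 1)) * (a - l j) := mul_le_mul_of_nonneg_right h3 hd.le
        _ = 2 * ((n - 1) * (a - l j)) := by ring
        _ ≤ _ := by linarith
    have h5 : (n : ℝ) * ((1 + ε) * (a - l j)) ≤ n * (2 * a) := by linarith
    exact le_of_mul_le_mul_left h5 (by linarith)
  · intro y hy hdeg
    have h1 := diag_inequality hn hΘ hlΘ hl h0 hy hdeg
    rw [← ha] at h1 ⊢
    have h2 : ((1 + ε) * a ^ 2 - 1) / (a * (1 + a ^ 2)) * (1 + a ^ 2) ≤ 2 * a - 2 / n * a := by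
      have : ((1 + ε) * a ^ 2 - 1) / (a * (1 + a ^ 2)) * (1 + a ^ 2) = (1 + ε) * a - 1 / a := by
        field_simp
      rw [this]
      have : 0 < 1 / a := by positivity
      nlinarith
    nlinarith [mul_le_mul_of_nonneg_right h2 (sq_nonneg (y 0))]

theorem exists_sum_eq_of_eq_two (hn : n = 2) :
    ∃ j₁ : Fin n, j₁ ≠ 0 ∧ (∀ j, j = 0 ∨ j = j₁) ∧ ∀ F : Fin n → ℝ, ∑ j, F j = F 0 + F j₁ := by
  subst hn
  refine ⟨1, Fin.ne_of_val_ne (by simp), fun j => by fin_cases j <;> simp, fun F => Fin.sum_univ_two F⟩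

/-- In dimension two the Jacobi inequality reduces to one differential inequality. -/
theorem jacobiAt_two {j₁ : Fin n} (hj : j₁ ≠ 0) (hj' : ∀ j, j = 0 ∨ j = j₁)
    (hsum : ∀ F : Fin n → ℝ, ∑ j, F j = F 0 + F j₁) (hl : l j₁ ≤ l 0)
    {G G' : ℝ → ℝ} {G'' R : ℝ} {V : Set ℝ} (hG : ∀ᶠ y in 𝓝 (l 0), HasDerivAt G (G' y) y)
    (hG' : HasDerivAt G' G'' (l 0)) (hV : V ∈ 𝓝 (l 0)) (hanti : AntitoneOn G V)
    (hneg : G' (l 0) ≤ 0) (hR : G' (l 0) * R + G'' ≤ 0) (hoff : R * (l 0 - l j₁) ≤ 2) :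
    JacobiAt G l := by
  refine ⟨G', G'', R, V, hG, hG', hV, hanti, hneg, hR, fun j hlt => ?_, fun y hy hdeg => ?_⟩
  · rcases hj' j with rfl | rfl
    · exact absurd hlt (lt_irrefl _)
    · exact hoff
  · rw [hsum] at hy ⊢
    simp only [if_true, hj, if_false, zero_add]
    have hy1 : y j₁ = -y 0 := by linarith
    by_cases hd : l j₁ = l 0
    · have := hdeg j₁ hj hd
      have h0 : y 0 = 0 := by linarith
      simp [this, h0]
    · have hlt := lt_of_le_of_ne hl hd
      rw [hy1, neg_sq, ← add_mul, one_add_mul_div_sub _ _ hlt]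
      refine mul_le_mul_of_nonneg_right ?_ (sq_nonneg _)
      rw [le_div_iff₀ (by linarith)]
      nlinarith [mul_le_mul_of_nonneg_left hoff (by positivity : 0 ≤ 1 + l 0 ^ 2)]

end Jacobi


/-! ### The barrier and its strict subharmonicity. -/

section Barrier

variable {n : ℕ}

theorem norm_sq_eq_sum_frame (e : OrthonormalBasis (Fin n) ℝ (EuclideanSpace ℝ (Fin n)))
    (L : EuclideanSpace ℝ (Fin n) →L[ℝ] ℝ) : ‖L‖ ^ 2 = ∑ i, L (e i) ^ 2 := by
  have h1 : ∀ v, inner ℝ ((InnerProductSpace.toDual ℝ _).symm L) v = L v := fun v =>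
    InnerProductSpace.toDual_symm_apply
  rw [← (InnerProductSpace.toDual ℝ (EuclideanSpace ℝ (Fin n))).symm.norm_map L,
    ← e.sum_sq_norm_inner_left]
  simp [h1]

/-- The function `-|x - y|² / 2 - τ ((x - y) · Du - u) + 4 τ² |Du|²`. -/
def barrier (u : EuclideanSpace ℝ (Fin n) → ℝ) (y : EuclideanSpace ℝ (Fin n)) (τ : ℝ)
    (x : EuclideanSpace ℝ (Fin n)) : ℝ :=
  -(1 / 2) * ‖x - y‖ ^ 2 - τ * (fderiv ℝ u x (x - y) - u x) + 4 * τ ^ 2 * ‖fderiv ℝ u x‖ ^ 2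

theorem barrier_eq_frame (u : EuclideanSpace ℝ (Fin n) → ℝ) (y : EuclideanSpace ℝ (Fin n)) (τ : ℝ)
    (e : OrthonormalBasis (Fin n) ℝ (EuclideanSpace ℝ (Fin n))) (x : EuclideanSpace ℝ (Fin n)) :
    barrier u y τ x = -(1 / 2) * (∑ i, inner ℝ (e i) (x - y) * inner ℝ (e i) (x - y)) -
      τ * (∑ i, inner ℝ (e i) (x - y) * dirDeriv (e i) u x - u x) +
      4 * τ ^ 2 * ∑ i, dirDeriv (e i) u x * dirDeriv (e i) u x := by
  have h1 : ‖x - y‖ ^ 2 = ∑ i, inner ℝ (e i) (x - y) * inner ℝ (e i) (x - y) := by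
    rw [← e.sum_sq_norm_inner_right]
    simp [sq]
  have h2 : fderiv ℝ u x (x - y) = ∑ i, inner ℝ (e i) (x - y) * dirDeriv (e i) u x := by
    conv_lhs => rw [← e.sum_repr (x - y)]
    simp [dirDeriv, e.repr_apply_apply, inner_sub_right]
  rw [barrier, h1, h2, norm_sq_eq_sum_frame e]
  simp [dirDeriv, sq]

theorem hasJet_inner_frame (e : OrthonormalBasis (Fin n) ℝ (EuclideanSpace ℝ (Fin n)))
    (x y : EuclideanSpace ℝ (Fin n)) (i k : Fin n) :
    HasJet (fun t : ℝ => inner ℝ (e i) (x + t • e k - y)) (inner ℝ (e i) (x - y))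
      (if i = k then 1 else 0) 0 := by
  have := (HasJet.const (inner ℝ (e i) (x - y))).add
    (HasJet.id.mul (HasJet.const (if i = k then (1 : ℝ) else 0)))
  convert! this using 1
  · funext t
    rw [add_sub_right_comm, inner_add_right, inner_smul_right, e.inner_eq_ite]
  · simp
  · simp
  · simp

variable {s : Set (EuclideanSpace ℝ (Fin n))} {u : EuclideanSpace ℝ (Fin n) → ℝ}
  {x : EuclideanSpace ℝ (Fin n)}
  {e : OrthonormalBasis (Fin n) ℝ (EuclideanSpace ℝ (Fin n))} {l : Fin n → ℝ}

theorem hasJet_gradient (hs : IsOpen s) (hu : ContDiffOn ℝ ∞ u s) (hx : x ∈ s)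
    (he : ∀ i, (hessian u x).mulVec (e i) = l i • (e i : Fin n → ℝ)) (i k : Fin n) :
    HasJet (fun t : ℝ => dirDeriv (e i) u (x + t • e k)) (dirDeriv (e i) u x)
      (if i = k then l k else 0) (thirdDeriv u x e k k i) := by
  have := hasJet_line (e k) hs (contDiffOn_dirDeriv (e i) hs hu) hx
  rw [dirDeriv_dirDeriv_eigenframe hs hu hx he] at this
  convert! this using 1
  · by_cases h : i = k
    · subst h; simp
    · simp [h, Ne.symm h]
  · rw [thirdDeriv_swap₁₃ hs hu hx, thirdDeriv_swap₁₂ hs hu hx]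
    rfl

theorem hasJet_function (hs : IsOpen s) (hu : ContDiffOn ℝ ∞ u s) (hx : x ∈ s)
    (he : ∀ i, (hessian u x).mulVec (e i) = l i • (e i : Fin n → ℝ)) (k : Fin n) :
    HasJet (fun t : ℝ => u (x + t • e k)) (u x) (dirDeriv (e k) u x) (l k) := by
  have := hasJet_line (e k) hs hu hx
  rw [dirDeriv_dirDeriv_eigenframe hs hu hx he] at this
  simpa using this

/-- In the second derivative, the coefficients of the third derivatives `uₖₖᵢ` do not depend on `k`.
Summing over `k` with weights `(1 + lₖ²)⁻¹` therefore cancels these terms by the first variation of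
the equation. -/
theorem hasJet_barrier (hs : IsOpen s) (hu : ContDiffOn ℝ ∞ u s) (hx : x ∈ s)
    (he : ∀ i, (hessian u x).mulVec (e i) = l i • (e i : Fin n → ℝ))
    (y : EuclideanSpace ℝ (Fin n)) (τ : ℝ) (k : Fin n) :
    HasJet (fun t : ℝ => barrier u y τ (x + t • e k)) (barrier u y τ x)
      (-(1 + τ * l k) * inner ℝ (e k) (x - y) + 8 * τ ^ 2 * (dirDeriv (e k) u x * l k))
      (-1 - τ * l k + 8 * τ ^ 2 * l k ^ 2 + ∑ i, (8 * τ ^ 2 * dirDeriv (e i) u x -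
        τ * inner ℝ (e i) (x - y)) * thirdDeriv u x e k k i) := by
  have hξ := fun i => hasJet_inner_frame e x y i k
  have hp := fun i => hasJet_gradient hs hu hx he i k
  have h := (((HasJet.sum Finset.univ fun i => (hξ i).mul (hξ i)).const_mul (-(1 / 2))).sub
    (((HasJet.sum Finset.univ fun i => (hξ i).mul (hp i)).sub
      (hasJet_function hs hu hx he k)).const_mul τ)).add
    ((HasJet.sum Finset.univ fun i => (hp i).mul (hp i)).const_mul (4 * τ ^ 2))
  convert! h using 1
  · funext t; rw [barrier_eq_frame u y τ e]
  · rw [barrier_eq_frame u y τ e]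
  · simp [Finset.sum_add_distrib]
    ring
  · simp [Finset.sum_add_distrib, sub_mul, Finset.mul_sum, mul_assoc, mul_add]
    have : ∀ F : Fin n → ℝ, 4 * (τ ^ 2 * ∑ i, F i) = ∑ i, 4 * (τ ^ 2 * F i) := fun F => by
      rw [Finset.mul_sum, Finset.mul_sum]
    have e8 : ∑ i, 8 * (τ ^ 2 * (dirDeriv (e i) u x * thirdDeriv u x e k k i)) =
        2 * ∑ i, 4 * (τ ^ 2 * (dirDeriv (e i) u x * thirdDeriv u x e k k i)) := by
      rw [Finset.mul_sum]
      exact Finset.sum_congr rfl fun i _ => by ring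
    have e9 : ∑ i, 4 * (τ ^ 2 * (thirdDeriv u x e k k i * dirDeriv (e i) u x)) =
        ∑ i, 4 * (τ ^ 2 * (dirDeriv (e i) u x * thirdDeriv u x e k k i)) :=
      Finset.sum_congr rfl fun i _ => by ring
    have e10 : ∑ i, τ * (inner ℝ (e i) (x - y) * thirdDeriv u x e k k i) =
        τ * ∑ i, inner ℝ (e i) (x - y) * thirdDeriv u x e k k i := (Finset.mul_sum ..).symm
    rw [e8, e9, e10]
    ring

/-- The barrier is strictly subharmonic, after exponentiation, away from its centre. -/
theorem barrier_algebra [NeZero n] {ξ p : Fin n → ℝ} {τ r A c : ℝ}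
    (hpos : ∀ i j, i ≠ j → 0 ≤ l i + l j) (hτ : 0 < τ) (hτ1 : τ ≤ 1)
    (hξ : r ^ 2 ≤ ∑ i, ξ i ^ 2) (hp : ∑ i, p i ^ 2 ≤ A ^ 2) (hτA : 1280 * τ ^ 2 * A ^ 2 ≤ r ^ 2)
    (hc0 : 0 ≤ c) (hc : 2 * n < c * (τ ^ 2 * r ^ 2 / 20)) :
    0 < ∑ k, (1 + l k ^ 2)⁻¹ * ((-1 - τ * l k + 8 * τ ^ 2 * l k ^ 2) +
      c * (-(1 + τ * l k) * ξ k + 8 * τ ^ 2 * (p k * l k)) ^ 2) := by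
  -- If some `τ l k < -1/2`, the phase condition forces `τ l j > 1/2` for all other `j`, and `8 s² -
  -- s - 1 > 0` for `|s| > 1/2`. Otherwise `1 + τ l k ≥ 1/2` for every `k`, and the gradient term,
  -- large because `|x - y| ≥ r`, compensates.
  by_cases hB : ∃ k, τ * l k < -(1 / 2)
  · obtain ⟨k, hk⟩ := hB
    refine Finset.sum_pos (fun j _ => mul_pos (by positivity) ?_) ⟨0, Finset.mem_univ _⟩
    refine add_pos_of_pos_of_nonneg ?_ (by positivity)
    by_cases hj : j = k
    · rw [hj]; nlinarith
    · have h1 := hpos j k hj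
      have h2 : 1 / 2 < τ * l j := by nlinarith
      nlinarith
  · push Not at hB
    have hterm : ∀ k, -2 + c * (τ ^ 2 * ξ k ^ 2 / 10 - 64 * τ ^ 4 * p k ^ 2) ≤
        (1 + l k ^ 2)⁻¹ * ((-1 - τ * l k + 8 * τ ^ 2 * l k ^ 2) +
      c * (-(1 + τ * l k) * ξ k + 8 * τ ^ 2 * (p k * l k)) ^ 2) := by
      intro k
      have hg : 0 < 1 + l k ^ 2 := by positivity
      rw [inv_mul_eq_div, le_div_iff₀ hg, add_mul]
      refine add_le_add ?_ ?_
      · nlinarith [sq_nonneg (τ * l k), sq_nonneg (l k + 1), sq_nonneg (τ + l k)]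
      · rw [mul_assoc]
        refine mul_le_mul_of_nonneg_left ?_ hc0
        have h1 : (1 + (τ * l k) ^ 2) ≤ 5 * (1 + τ * l k) ^ 2 := by nlinarith [hB k]
        have h2 : τ ^ 2 * (1 + l k ^ 2) ≤ 1 + (τ * l k) ^ 2 := by nlinarith
        have h3 : τ ^ 2 * (1 + l k ^ 2) * ξ k ^ 2 ≤ 5 * (1 + τ * l k) ^ 2 * ξ k ^ 2 :=
          mul_le_mul_of_nonneg_right (h2.trans h1) (sq_nonneg _)
        -- This square amounts to `(α + β)² ≥ α² / 2 - β²`.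
        have h4 : 0 ≤ (-(1 + τ * l k) * ξ k + 2 * (8 * τ ^ 2 * (p k * l k))) ^ 2 := sq_nonneg _
        have h5 : 0 ≤ τ ^ 4 * p k ^ 2 := by positivity
        nlinarith
    refine lt_of_lt_of_le ?_ (Finset.sum_le_sum fun k _ => hterm k)
    rw [Finset.sum_add_distrib, ← Finset.mul_sum, Finset.sum_sub_distrib]
    simp only [mul_div_assoc, ← Finset.mul_sum, ← Finset.sum_div]
    have h1 : τ ^ 2 * r ^ 2 / 20 ≤ τ ^ 2 * ((∑ i, ξ i ^ 2) / 10) - 64 * τ ^ 4 * ∑ i, p i ^ 2 := by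
      have a1 : τ ^ 2 * r ^ 2 ≤ τ ^ 2 * ∑ i, ξ i ^ 2 := mul_le_mul_of_nonneg_left hξ (sq_nonneg _)
      have a2 : τ ^ 4 * ∑ i, p i ^ 2 ≤ τ ^ 4 * A ^ 2 := mul_le_mul_of_nonneg_left hp (by positivity)
      have a3 : τ ^ 2 * (1280 * τ ^ 2 * A ^ 2) ≤ τ ^ 2 * r ^ 2 :=
        mul_le_mul_of_nonneg_left hτA (sq_nonneg _)
      nlinarith
    have h2 := mul_le_mul_of_nonneg_left h1 hc0
    simp only [Finset.sum_const, Finset.card_univ, Fintype.card_fin, nsmul_eq_mul]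
    linarith

end Barrier

/-! ### The doubling inequality. -/

section Doubling

variable {n : ℕ} {u : EuclideanSpace ℝ (Fin n) → ℝ}

theorem bounds_of_c01Norm_le {s : Set (EuclideanSpace ℝ (Fin n))} (hs : IsOpen s) {A : ℝ≥0}
    (h : c01Norm u s ≤ A) {x : EuclideanSpace ℝ (Fin n)} (hx : x ∈ s) :
    |u x| ≤ A ∧ ‖fderiv ℝ u x‖ ≤ A := by
  constructor
  · have h1 : ‖u x‖ₑ ≤ A := (le_iSup₂ (f := fun x (_ : x ∈ s) => ‖u x‖ₑ) x hx).trans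
      (le_self_add.trans h)
    have h2 : ‖u x‖₊ ≤ A := by simpa [enorm] using h1
    simpa using (NNReal.coe_le_coe.2 h2)
  · refine norm_fderiv_le_of_lipschitzOn ℝ (hs.mem_nhds hx) (C := A) fun a ha b hb => ?_
    have h1 : edist (u a) (u b) / edist a b ≤ A :=
      ((le_iSup₂ (f := fun b (_ : b ∈ s) => edist (u a) (u b) / edist a b) b hb).trans
        (le_iSup₂ (f := fun a (_ : a ∈ s) => ⨆ b ∈ s, edist (u a) (u b) / edist a b) a ha)).trans
        (le_add_self.trans h)
    by_cases hab : a = b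
    · simp [hab]
    · rwa [ENNReal.div_le_iff (by simpa [edist_eq_zero] using hab) (edist_ne_top _ _)] at h1

/-- The paraboloid equals `-9/128` at radius `3/8` and exceeds `-4/128` inside radius `1/4`, so an
error of `1/128` preserves the order of these two levels. -/
theorem abs_barrier_add_le {A τ : ℝ} {x y : EuclideanSpace ℝ (Fin n)} (hτ : 0 ≤ τ) (hτ1 : τ ≤ 1)
    (hu : |u x| ≤ A) (hdu : ‖fderiv ℝ u x‖ ≤ A) (hxy : ‖x - y‖ ≤ 1)
    (hsmall : τ * (2 * A + 4 * A ^ 2) ≤ 1 / 128) :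
    |barrier u y τ x + 1 / 2 * ‖x - y‖ ^ 2| ≤ 1 / 128 := by
  have hA : 0 ≤ A := (abs_nonneg _).trans hu
  have h1 : |fderiv ℝ u x (x - y)| ≤ A := by
    calc |fderiv ℝ u x (x - y)| ≤ ‖fderiv ℝ u x‖ * ‖x - y‖ := (fderiv ℝ u x).le_opNorm _
      _ ≤ A * 1 := by gcongr
      _ = A := mul_one A
  have h2 : ‖fderiv ℝ u x‖ ^ 2 ≤ A ^ 2 := by gcongr
  have h3 : barrier u y τ x + 1 / 2 * ‖x - y‖ ^ 2 =
      4 * τ ^ 2 * ‖fderiv ℝ u x‖ ^ 2 - τ * (fderiv ℝ u x (x - y) - u x) := by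
    rw [barrier]; ring
  rw [h3]
  have h4 : τ ^ 2 * ‖fderiv ℝ u x‖ ^ 2 ≤ τ * A ^ 2 :=
    mul_le_mul (by nlinarith) h2 (sq_nonneg _) hτ
  have h5 : |τ * (fderiv ℝ u x (x - y) - u x)| ≤ τ * (2 * A) := by
    rw [abs_mul, abs_of_nonneg hτ]
    refine mul_le_mul_of_nonneg_left ?_ hτ
    exact (abs_sub _ _).trans (by linarith)
  have h6 := abs_le.1 h5
  have h7 : 0 ≤ τ ^ 2 * ‖fderiv ℝ u x‖ ^ 2 := by positivity
  rw [abs_le]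
  constructor <;> nlinarith

theorem continuousOn_barrier {s : Set (EuclideanSpace ℝ (Fin n))} (hs : IsOpen s)
    (hu : ContDiffOn ℝ ∞ u s) (y : EuclideanSpace ℝ (Fin n)) (τ : ℝ) :
    ContinuousOn (barrier u y τ) s := by
  have h1 := hu.continuousOn
  have h2 : ContinuousOn (fderiv ℝ u) s := hu.continuousOn_fderiv_of_isOpen hs (by simp)
  unfold barrier
  have h3 : ContinuousOn (fun x => fderiv ℝ u x (x - y)) s :=
    h2.clm_apply (continuousOn_id.sub continuousOn_const)
  exact ((by fun_prop : ContinuousOn (fun x => -(1 / 2) * ‖x - y‖ ^ 2) s).sub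
    ((h3.sub h1).const_mul τ)).add ((h2.norm.pow 2).const_mul (4 * τ ^ 2))

variable [NeZero n]

/-- The doubling inequality for a function `G (λ₁)` satisfying the Jacobi inequality. -/
theorem exists_doubling_constant (n : ℕ) [NeZero n] {r A : ℝ} (hr0 : 0 < r) (hr : r < 1 / 4)
    (hA : 0 ≤ A) :
    ∃ C : ℝ, 0 ≤ C ∧ ∀ (Θ : ℝ) (u : EuclideanSpace ℝ (Fin n) → ℝ) (y : EuclideanSpace ℝ (Fin n))
      (G : ℝ → ℝ), ((n : ℝ) - 2) * Real.pi / 2 ≤ Θ →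
      ContDiffOn ℝ ∞ u (Metric.ball 0 1) →
      IsSolutionOn Θ u (Metric.ball 0 1) →
      (∀ x ∈ Metric.ball 0 1, |u x| ≤ A ∧ ‖fderiv ℝ u x‖ ≤ A) →
      y ∈ Metric.ball 0 (1 / 2) →
      (∀ x ∈ Metric.ball 0 1, 0 < G (eigenvalue (hessian u x) 0)) →
      ContinuousOn (fun x => G (eigenvalue (hessian u x) 0)) (Metric.ball 0 1) →
      (∀ x ∈ Metric.ball 0 1, JacobiAt G (eigenvalue (hessian u x))) →
      ∀ z ∈ Metric.ball y (1 / 4), ∃ x ∈ Metric.ball y r,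
        G (eigenvalue (hessian u x) 0) ≤ C * G (eigenvalue (hessian u z) 0) := by
  have hn : (0 : ℝ) < n := by exact_mod_cast Nat.pos_of_ne_zero (NeZero.ne n)
  set τ : ℝ := r / (1000 * (1 + A) ^ 2) with hτdef
  have hτ : 0 < τ := by positivity
  have hτr : τ * (1000 * (1 + A) ^ 2) = r := by rw [hτdef]; field_simp
  have hτ1 : τ ≤ 1 := by nlinarith
  have hsmall : τ * (2 * A + 4 * A ^ 2) ≤ 1 / 128 := by nlinarith [mul_nonneg hτ.le hA]
  have hτA : 1280 * τ ^ 2 * A ^ 2 ≤ r ^ 2 := by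
    have h1 : 36 * (τ * A) ≤ r := by nlinarith [mul_nonneg hτ.le hA, mul_nonneg hτ.le (sq_nonneg A)]
    have h2 : (36 * (τ * A)) ^ 2 ≤ r ^ 2 := pow_le_pow_left₀ (by positivity) h1 2
    nlinarith [sq_nonneg (τ * A)]
  set c : ℝ := 60 * n / (τ ^ 2 * r ^ 2) with hcdef
  have hc0 : 0 < c := by positivity
  have hc : 2 * n < c * (τ ^ 2 * r ^ 2 / 20) := by
    have : c * (τ ^ 2 * r ^ 2 / 20) = 3 * n := by rw [hcdef]; field_simp; norm_num
    linarith
  -- On `|x - y| = 3/8` the barrier is at most `-9/128 + 1/128 = -1/16`, so subtracting `m` makes `η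
  -- ≤ 0` there. In `B_{1/4}(y)` it is at least `-5/128`, and everywhere in the ball at most
  -- `1/128`; these two levels give the doubling constant.
  set m : ℝ := Real.exp (c * (-(1 / 16))) with hm
  have hηpos : 0 < Real.exp (c * (-(5 / 128))) - m := by
    rw [hm, sub_pos, Real.exp_lt_exp]; linarith
  refine ⟨Real.exp (c * (1 / 128)) / (Real.exp (c * (-(5 / 128))) - m), by positivity, ?_⟩
  intro Θ u y G hΘ hu hsol hbd hy hGpos hGcont hJ z hz
  have hsub : Metric.closedBall y (3 / 8) ⊆ Metric.ball 0 1 := fun x hx => by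
    simp only [Metric.mem_closedBall, Metric.mem_ball] at hx hy ⊢
    linarith [dist_triangle x y 0]
  have hopen : IsOpen (Metric.ball (0 : EuclideanSpace ℝ (Fin n)) 1) := Metric.isOpen_ball
  set φ := barrier u y τ with hφ
  have hφbd : ∀ x ∈ Metric.closedBall y (3 / 8), |φ x + 1 / 2 * ‖x - y‖ ^ 2| ≤ 1 / 128 :=
    fun x hx => by
      have := hbd x (hsub hx)
      rw [mem_closedBall_iff_norm] at hx
      exact abs_barrier_add_le hτ.le hτ1 this.1 this.2 (by linarith) hsmall
  set η : EuclideanSpace ℝ (Fin n) → ℝ := fun x => Real.exp (c * φ x) - m with hη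
  have hηcont : ContinuousOn η (Metric.ball 0 1) :=
    ((continuousOn_barrier hopen hu y τ).const_mul c).rexp.sub continuousOn_const
  set F : EuclideanSpace ℝ (Fin n) → ℝ := fun x => η x / G (eigenvalue (hessian u x) 0) with hF
  have hFcont : ContinuousOn F (Metric.closedBall y (3 / 8)) :=
    (hηcont.div hGcont fun x hx => (hGpos x hx).ne').mono hsub
  have hzK : z ∈ Metric.closedBall y (3 / 8) :=
    Metric.closedBall_subset_closedBall (by norm_num) (Metric.ball_subset_closedBall hz)
  obtain ⟨x, hxK, hmax⟩ := (isCompact_closedBall y (3 / 8)).exists_isMaxOn ⟨z, hzK⟩ hFcont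
  have hηz : Real.exp (c * (-(5 / 128))) - m ≤ η z := by
    have h1 := (abs_le.1 (hφbd z hzK)).1
    rw [mem_ball_iff_norm] at hz
    have h2 : ‖z - y‖ ^ 2 ≤ (1 / 4) ^ 2 := pow_le_pow_left₀ (norm_nonneg _) hz.le 2
    simp only [hη]
    refine sub_le_sub_right (Real.exp_le_exp.2 (mul_le_mul_of_nonneg_left ?_ hc0.le)) _
    linarith
  have hGx := hGpos x (hsub hxK)
  have hGz := hGpos z (hsub hzK)
  have hFz : 0 < F z := div_pos (hηpos.trans_le hηz) hGz
  have hFx : 0 < F x := hFz.trans_le (hmax hzK)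
  have hηx : 0 < η x := by
    by_contra! h
    exact absurd hFx (not_lt.2 (div_nonpos_of_nonpos_of_nonneg h hGx.le))
  have hxint : x ∈ Metric.ball y (3 / 8) := by
    rw [mem_ball_iff_norm]
    rw [mem_closedBall_iff_norm] at hxK
    refine lt_of_le_of_ne hxK fun hxe => ?_
    have h1 := (abs_le.1 (hφbd x (by rw [mem_closedBall_iff_norm]; exact hxK))).2
    rw [hxe] at h1
    have h2 : Real.exp (c * φ x) ≤ m := by
      rw [hm]
      exact Real.exp_le_exp.2 (mul_le_mul_of_nonneg_left (by linarith) hc0.le)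
    simp only [hη] at hηx
    linarith
  by_cases hxr : x ∈ Metric.ball y r
  · refine ⟨x, hxr, ?_⟩
    have h1 : F z ≤ F x := hmax hzK
    simp only [hF] at h1
    rw [div_le_div_iff₀ hGz hGx] at h1
    have h2 : η x ≤ Real.exp (c * (1 / 128)) := by
      have h3 := (abs_le.1 (hφbd x hxK)).2
      have h4 : Real.exp (c * φ x) ≤ Real.exp (c * (1 / 128)) :=
        Real.exp_le_exp.2 (mul_le_mul_of_nonneg_left (by nlinarith [sq_nonneg ‖x - y‖]) hc0.le)
      have : 0 < m := Real.exp_pos _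
      simp only [hη]
      linarith
    rw [div_mul_eq_mul_div, le_div_iff₀ hηpos]
    calc _ ≤ G (eigenvalue (hessian u x) 0) * η z := mul_le_mul_of_nonneg_left hηz hGx.le
      _ = η z * G (eigenvalue (hessian u x) 0) := mul_comm _ _
      _ ≤ _ := h1
      _ ≤ _ := mul_le_mul_of_nonneg_right h2 hGz.le
  -- Outside `B_r(y)`, the function `κ η` touches `G (λ₁)` from below at the maximum point, so the
  -- Jacobi inequality contradicts the strict subharmonicity of `exp (c φ)`.
  · exfalso
    have hxr' : r ≤ ‖x - y‖ := by rw [mem_ball_iff_norm] at hxr; exact not_lt.1 hxr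
    have hxS := hsub hxK
    obtain ⟨e, he⟩ := exists_eigenframe (hessian_isHermitian hopen hu hxS)
    set l := eigenvalue (hessian u x) with hl
    set κ := G (l 0) / η x with hκ
    have hκpos : 0 < κ := div_pos hGx hηx
    have hjet : ∀ k, HasJet (fun t : ℝ => κ * η (x + t • e k)) _ _ _ := fun k =>
      ((HasJet.comp (G := fun a => Real.exp (c * a) - m) (G' := fun a => c * Real.exp (c * a))
        (G'' := c ^ 2 * Real.exp (c * φ x)) (.of_forall fun a => by
          have := (((hasDerivAt_id a).const_mul c).exp).sub_const m
          simpa [mul_comm] using this) (by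
          have := (((hasDerivAt_id (φ x)).const_mul c).exp).const_mul c
          convert! this using 1
          simp only [id]
          ring) (hasJet_barrier hopen hu hxS he y τ k)).const_mul κ)
    have hle := sum_mul_le_zero_of_jacobiAt hΘ hopen hu hsol hxS hl he (hJ x hxS)
      (W := fun w => κ * η w) hjet (by
      filter_upwards [Metric.isOpen_ball.mem_nhds hxint] with w hw
      have hwK := Metric.ball_subset_closedBall hw
      have h1 : F w ≤ F x := hmax hwK
      simp only [hF] at h1
      rw [div_le_div_iff₀ (hGpos w (hsub hwK)) hGx] at h1
      rw [hκ, div_mul_eq_mul_div, div_le_iff₀ hηx]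
      linarith) (by rw [hκ]; field_simp)
    have hphase : ∑ i, Real.arctan (l i) = Θ := hsol x hxS
    have hpos := barrier_algebra (l := l) (ξ := fun i => inner ℝ (e i) (x - y))
      (p := fun i => dirDeriv (e i) u x) (τ := τ) (r := r) (A := A) (c := c)
      (fun i j hij => add_nonneg_of_phase hΘ hphase hij) hτ hτ1 (by
        have := e.sum_sq_norm_inner_right (x - y)
        simp only [Real.norm_eq_abs, sq_abs] at this
        rw [this]
        exact pow_le_pow_left₀ hr0.le hxr' 2) (by
        have := norm_sq_eq_sum_frame e (fderiv ℝ u x)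
        simp only [dirDeriv]
        rw [← this]
        exact pow_le_pow_left₀ (norm_nonneg _) (hbd x hxS).2 2) hτA hc0.le hc
    have hzero : ∑ k, (1 + l k ^ 2)⁻¹ * ∑ i, (8 * τ ^ 2 * dirDeriv (e i) u x -
        τ * inner ℝ (e i) (x - y)) * thirdDeriv u x e k k i = 0 := by
      simp only [Finset.mul_sum]
      rw [Finset.sum_comm]
      refine Finset.sum_eq_zero fun i _ => ?_
      have := (equation_variation_frame hopen hu hsol hxS he i).1
      simp only [mul_left_comm _ (_ - _), ← Finset.mul_sum]
      rw [this, mul_zero]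
    have hprod : 0 < κ * (c * Real.exp (c * φ x)) := by positivity
    have := mul_pos hprod hpos
    refine absurd hle (not_le.2 (lt_of_lt_of_eq this ?_))
    rw [← add_zero (κ * _ * _), ← mul_zero (κ * (c * Real.exp (c * φ x))), ← hzero, ← mul_add,
      ← Finset.sum_add_distrib, Finset.mul_sum]
    refine Finset.sum_congr rfl fun k _ => ?_
    ring

end Doubling


/-! ### Dimension two: the half-angle parametrization and an interior estimate. -/

section TwoDim

variable {a b t q : ℝ}

/-- In dimension two, the eigenvalues `a ≥ b` are parametrized by `t = tan (Θ / 2)` and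
`q = tan ((θ₁ - θ₂) / 2)`. -/
theorem exists_halfangle_parameter {Θ : ℝ} (hΘ : 0 ≤ Θ)
    (h : Real.arctan a + Real.arctan b = Θ) (hab : b ≤ a) :
    ∃ q, 0 ≤ q ∧ 0 ≤ Real.tan (Θ / 2) ∧ Real.tan (Θ / 2) * q < 1 ∧
      a * (1 - Real.tan (Θ / 2) * q) = Real.tan (Θ / 2) + q ∧
      b * (1 + Real.tan (Θ / 2) * q) = Real.tan (Θ / 2) - q := by
  set δ := (Real.arctan a - Real.arctan b) / 2 with hδ
  have ha := Real.arctan_lt_pi_div_two a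
  have hb := Real.arctan_lt_pi_div_two b
  have hb' := Real.neg_pi_div_two_lt_arctan b
  have hm := Real.arctan_mono hab
  have hα0 : 0 ≤ Θ / 2 := by linarith
  have hα1 : Θ / 2 < Real.pi / 2 := by linarith
  have hδ0 : 0 ≤ δ := by linarith
  have hδ1 : δ < Real.pi / 2 := by linarith
  have hcα : 0 < Real.cos (Θ / 2) := Real.cos_pos_of_mem_Ioo ⟨by linarith, hα1⟩
  have hcδ : 0 < Real.cos δ := Real.cos_pos_of_mem_Ioo ⟨by linarith, hδ1⟩
  have e1 : Θ / 2 + δ = Real.arctan a := by rw [hδ, ← h]; ring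
  have e2 : Θ / 2 - δ = Real.arctan b := by rw [hδ, ← h]; ring
  have hc1 : 0 < Real.cos (Θ / 2 + δ) := by rw [e1]; exact Real.cos_arctan_pos a
  have hc2 : 0 < Real.cos (Θ / 2 - δ) := by rw [e2]; exact Real.cos_arctan_pos b
  have ha' : a = Real.sin (Θ / 2 + δ) / Real.cos (Θ / 2 + δ) := by
    rw [← Real.tan_eq_sin_div_cos, e1, Real.tan_arctan]
  have hb' : b = Real.sin (Θ / 2 - δ) / Real.cos (Θ / 2 - δ) := by
    rw [← Real.tan_eq_sin_div_cos, e2, Real.tan_arctan]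
  have k1 : 1 - Real.tan (Θ / 2) * Real.tan δ =
      Real.cos (Θ / 2 + δ) / (Real.cos (Θ / 2) * Real.cos δ) := by
    rw [Real.tan_eq_sin_div_cos, Real.tan_eq_sin_div_cos, Real.cos_add]
    field_simp
  have k2 : 1 + Real.tan (Θ / 2) * Real.tan δ =
      Real.cos (Θ / 2 - δ) / (Real.cos (Θ / 2) * Real.cos δ) := by
    rw [Real.tan_eq_sin_div_cos, Real.tan_eq_sin_div_cos, Real.cos_sub]
    field_simp
  refine ⟨Real.tan δ, Real.tan_nonneg_of_nonneg_of_le_pi_div_two hδ0 hδ1.le,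
    Real.tan_nonneg_of_nonneg_of_le_pi_div_two hα0 hα1.le, ?_, ?_, ?_⟩
  · have : 0 < 1 - Real.tan (Θ / 2) * Real.tan δ := by rw [k1]; positivity
    linarith
  · rw [k1, ha', div_mul_div_comm, mul_comm (Real.sin _), mul_div_mul_left _ _ hc1.ne',
      Real.sin_add, Real.tan_eq_sin_div_cos, Real.tan_eq_sin_div_cos]
    field_simp
  · rw [k2, hb', div_mul_div_comm, mul_comm (Real.sin _), mul_div_mul_left _ _ hc2.ne',
      Real.sin_sub, Real.tan_eq_sin_div_cos, Real.tan_eq_sin_div_cos]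
    field_simp

theorem sub_eq_of_halfangle (htq : t * q < 1) (h : a * (1 - t * q) = t + q) :
    a - t = q * (1 + t * a) := by
  have : (1 - t * q) ≠ 0 := by linarith
  linear_combination h

theorem one_add_mul_of_halfangle (htq : t * q < 1) (h : a * (1 - t * q) = t + q) :
    1 + t * a = (1 + t ^ 2) / (1 - t * q) := by
  have : (1 - t * q) ≠ 0 := by linarith
  rw [eq_div_iff this]
  linear_combination t * h

theorem le_of_halfangle (hq : 0 ≤ q) (ht : 0 ≤ t) (htq : t * q < 1)
    (h : a * (1 - t * q) = t + q) : t + q ≤ a := by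
  have h1 : 0 ≤ t * q := mul_nonneg ht hq
  have h2 : 0 ≤ a := by
    by_contra! hneg
    nlinarith
  nlinarith

theorem sub_eq_two_mul_of_halfangle (htq : t * q < 1) (htq' : 0 ≤ t * q)
    (ha : a * (1 - t * q) = t + q) (hb : b * (1 + t * q) = t - q) :
    a - b = 2 * q * (1 + t ^ 2) / ((1 - t * q) * (1 + t * q)) := by
  have h1 : (1 - t * q) ≠ 0 := by linarith
  have h2 : (1 + t * q) ≠ 0 := by linarith
  rw [eq_div_iff (mul_ne_zero h1 h2)]
  linear_combination (1 + t * q) * ha - (1 - t * q) * hb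

/-- Both weights are comparable to `(1 + q²)⁻¹` uniformly in `t`: the first by `a ≥ q`, the second
by `(1 + b²) (1 + t q)² = (1 + t²) (1 + q²)` and `t q < 1`. The factor `5` is `1 + 4`. -/
theorem sq_le_of_halfangle {B : ℝ} (hq : 0 ≤ q) (ht0 : 0 ≤ t) (htq : t * q < 1)
    (ha : a * (1 - t * q) = t + q) (hb : b * (1 + t * q) = t - q) (hB : 0 ≤ B)
    (h : (1 + a ^ 2)⁻¹ * (a ^ 2 - B) + (1 + b ^ 2)⁻¹ * (b ^ 2 - B) ≤ 0) : q ^ 2 ≤ B * 5 := by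
  have hqa : q ≤ a := by linarith [le_of_halfangle hq ht0 htq ha]
  have htq0 : 0 ≤ t * q := mul_nonneg ht0 hq
  have hg1 : (1 + b ^ 2)⁻¹ ≤ 4 / (1 + q ^ 2) := by
    rw [inv_eq_one_div, div_le_div_iff₀ (by positivity) (by positivity)]
    have h1 : (1 + b ^ 2) * (1 + t * q) ^ 2 = (1 + t ^ 2) * (1 + q ^ 2) := by
      linear_combination (b * (1 + t * q) + (t - q)) * hb
    have h2 : (1 + t * q) ^ 2 ≤ 4 := by nlinarith
    have h3 : (1 + b ^ 2) * (1 + t * q) ^ 2 ≤ (1 + b ^ 2) * 4 :=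
      mul_le_mul_of_nonneg_left h2 (by positivity)
    nlinarith [mul_nonneg (sq_nonneg t) (by positivity : 0 ≤ 1 + q ^ 2)]
  have hg0 : (1 + a ^ 2)⁻¹ ≤ 1 / (1 + q ^ 2) := by
    rw [inv_eq_one_div]
    exact one_div_le_one_div_of_le (by positivity) (by nlinarith)
  have hg0' : q ^ 2 / (1 + q ^ 2) ≤ (1 + a ^ 2)⁻¹ * a ^ 2 := by
    rw [inv_mul_eq_div, div_le_div_iff₀ (by positivity) (by positivity)]
    nlinarith
  have hfin : q ^ 2 / (1 + q ^ 2) ≤ B * (5 / (1 + q ^ 2)) := by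
    have h1 : 0 ≤ (1 + b ^ 2)⁻¹ * b ^ 2 := by positivity
    have h2 := mul_le_mul_of_nonneg_left hg1 hB
    have h3 := mul_le_mul_of_nonneg_left hg0 hB
    have h4 : B * (5 / (1 + q ^ 2)) = B * (4 / (1 + q ^ 2)) + B * (1 / (1 + q ^ 2)) := by ring
    rw [h4]
    linarith
  rw [← mul_div_assoc, div_le_div_iff_of_pos_right (by positivity)] at hfin
  exact hfin

variable {n : ℕ} [NeZero n] {l : Fin n → ℝ}

/-- The argument of the logarithm equals `q` at `l 0`. This is the borderline case: `G' R + G'' = 0`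
and `R (l₀ - l₁) = 2` hold with equality. -/
theorem jacobiAt_neg_log {j₁ : Fin n} (hj : j₁ ≠ 0) (hj' : ∀ j, j = 0 ∨ j = j₁)
    (hsum : ∀ F : Fin n → ℝ, ∑ j, F j = F 0 + F j₁) (hl : l j₁ ≤ l 0)
    (hq : 0 < q) (ht : 0 ≤ t) (htq : t * q < 1) (ha : l 0 * (1 - t * q) = t + q)
    (hb : l j₁ * (1 + t * q) = t - q) :
    JacobiAt (fun y => -Real.log ((y - t) / (1 + t * y))) l := by
  have hlt : t < l 0 := by linarith [le_of_halfangle hq.le ht htq ha]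
  have hden : ∀ y, t < y → 0 < 1 + t * y := fun y hy => by nlinarith
  have hev : ∀ᶠ y in 𝓝 (l 0), t < y := lt_mem_nhds hlt
  have hd1 : ∀ y, HasDerivAt (fun y => y - t) 1 y := fun y => (hasDerivAt_id y).sub_const t
  have hd2 : ∀ y, HasDerivAt (fun y => 1 + t * y) t y := fun y => by
    simpa using ((hasDerivAt_id y).const_mul t).const_add 1
  have h1 : 0 < l 0 - t := by linarith
  have h2 := hden _ hlt
  refine jacobiAt_two hj hj' hsum hl (G' := fun y => t / (1 + t * y) - 1 / (y - t))
    (G'' := (1 / (l 0 - t)) ^ 2 - (t / (1 + t * l 0)) ^ 2)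
    (R := 1 / (l 0 - t) + t / (1 + t * l 0)) (V := Set.Ioi t) ?_ ?_ (Ioi_mem_nhds hlt) ?_ ?_ ?_ ?_
  · filter_upwards [hev.eventually_nhds] with y hy
    have hy0 := hy.self_of_nhds
    have k1 := ((hd2 y).log (hden y hy0).ne').sub ((hd1 y).log (sub_pos.2 hy0).ne')
    refine k1.congr_of_eventuallyEq ?_
    filter_upwards [hy] with w hw
    rw [Real.log_div (sub_pos.2 hw).ne' (hden w hw).ne']
    simp
  · have k1 := ((hasDerivAt_const (l 0) t).div (hd2 (l 0)) h2.ne').sub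
      ((hasDerivAt_const (l 0) (1 : ℝ)).div (hd1 (l 0)) h1.ne')
    convert! k1 using 1
    field_simp
    ring
  · intro y hy z hz hyz
    simp only [Set.mem_Ioi] at hy hz
    refine neg_le_neg (Real.log_le_log (div_pos (sub_pos.2 hy) (hden y hy)) ?_)
    rw [div_le_div_iff₀ (hden y hy) (hden z hz)]
    nlinarith [sq_nonneg t]
  · rw [sub_nonpos, div_le_div_iff₀ h2 h1]
    nlinarith
  · exact le_of_eq (by ring)
  · have e1 := sub_eq_of_halfangle htq ha
    have e2 := one_add_mul_of_halfangle htq ha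
    have e3 := sub_eq_two_mul_of_halfangle htq (mul_nonneg ht hq.le) ha hb
    have h3 : 1 - t * q ≠ 0 := by linarith
    have h4 : 1 + t * q ≠ 0 := by nlinarith [mul_nonneg ht hq.le]
    have h5 : 1 + t ^ 2 ≠ 0 := by positivity
    rw [e1, e2, e3]
    refine le_of_eq ?_
    field_simp
    exact div_self (by linarith)

/-- With `R = 2 t / (1 + t l₀)`, the condition `R (l₀ - l₁) ≤ 2` reads `1 + t l₁ ≥ 0`, which follows
from `(1 + t l₁) (1 + t q) = 1 + t²`. -/
theorem jacobiAt_inv {j₁ : Fin n} (hj : j₁ ≠ 0) (hj' : ∀ j, j = 0 ∨ j = j₁)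
    (hsum : ∀ F : Fin n → ℝ, ∑ j, F j = F 0 + F j₁) (hl : l j₁ ≤ l 0)
    (hq : 0 ≤ q) (ht : 0 ≤ t) (htq : t * q < 1) (ha : l 0 * (1 - t * q) = t + q)
    (hb : l j₁ * (1 + t * q) = t - q) :
    JacobiAt (fun y => (1 + t * y)⁻¹) l := by
  have h0 : 0 ≤ l 0 := by linarith [le_of_halfangle hq ht htq ha]
  have h2 : 0 < 1 + t * l 0 := by positivity
  have hd2 : ∀ y, HasDerivAt (fun y => 1 + t * y) t y := fun y => by
    simpa using ((hasDerivAt_id y).const_mul t).const_add 1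
  have hopen : IsOpen {y : ℝ | 0 < 1 + t * y} :=
    isOpen_lt continuous_const (by fun_prop)
  have hV : {y : ℝ | 0 < 1 + t * y} ∈ 𝓝 (l 0) := hopen.mem_nhds h2
  refine jacobiAt_two hj hj' hsum hl (G' := fun y => -t / (1 + t * y) ^ 2)
    (G'' := 2 * t ^ 2 / (1 + t * l 0) ^ 3) (R := 2 * t / (1 + t * l 0)) ?_ ?_ hV ?_ ?_ ?_ ?_
  · filter_upwards [hV] with y hy
    exact (hd2 y).inv hy.ne'
  · have k1 := (hasDerivAt_const (l 0) (-t)).div ((hd2 (l 0)).pow 2) (pow_pos h2 2).ne'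
    convert! k1 using 1
    simp only [Pi.pow_apply]
    field_simp
    ring
  · intro y hy z hz hyz
    exact inv_anti₀ hy (by nlinarith)
  · exact div_nonpos_of_nonpos_of_nonneg (by linarith) (sq_nonneg _)
  · refine le_of_eq ?_
    field_simp
    ring
  · have h3 : 0 ≤ t * q := mul_nonneg ht hq
    have h4 : 0 ≤ 1 + t * l j₁ := by
      have : (1 + t * l j₁) * (1 + t * q) = 1 + t ^ 2 := by linear_combination t * hb
      by_contra! hneg
      nlinarith [sq_nonneg t]
    rw [div_mul_eq_mul_div, div_le_iff₀ h2]
    nlinarith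

theorem hasJet_normSq_frame {m : ℕ}
    (e : OrthonormalBasis (Fin m) ℝ (EuclideanSpace ℝ (Fin m)))
    (x z : EuclideanSpace ℝ (Fin m)) (k : Fin m) :
    HasJet (fun t : ℝ => ‖x + t • e k - z‖ ^ 2) (‖x - z‖ ^ 2) (2 * inner ℝ (e k) (x - z)) 2 := by
  have h := HasJet.sum Finset.univ fun i =>
    (hasJet_inner_frame e x z i k).mul (hasJet_inner_frame e x z i k)
  have hn : ∀ v, ‖v‖ ^ 2 = ∑ i, inner ℝ (e i) v * inner ℝ (e i) v := fun v => by
    rw [← e.sum_sq_norm_inner_right]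
    simp [sq]
  convert! h using 1
  · funext t; exact hn _
  · exact hn _
  · simp [Finset.sum_add_distrib, two_mul]
  · simp

/-- In dimension two, an interior bound for `tan ((θ₁ - θ₂) / 2)`. -/
theorem halfangle_bound {u : EuclideanSpace ℝ (Fin n) → ℝ} {Θ A : ℝ} (hn : n = 2) (hΘ : 0 ≤ Θ)
    (hu : ContDiffOn ℝ ∞ u (Metric.ball 0 1)) (hsol : IsSolutionOn Θ u (Metric.ball 0 1))
    (hbd : ∀ x ∈ Metric.ball 0 1, ‖fderiv ℝ u x‖ ≤ A)
    {z : EuclideanSpace ℝ (Fin n)} (hz : z ∈ Metric.ball 0 (3 / 4)) :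
    (eigenvalue (hessian u z) 0 - Real.tan (Θ / 2)) /
      (1 + Real.tan (Θ / 2) * eigenvalue (hessian u z) 0) ≤ 56 * Real.exp (1 / 2 * A ^ 2) := by
  obtain ⟨j₁, hj, hj', hsum⟩ := exists_sum_eq_of_eq_two hn
  have hopen : IsOpen (Metric.ball (0 : EuclideanSpace ℝ (Fin n)) 1) := Metric.isOpen_ball
  have hsub : Metric.closedBall z (1 / 8) ⊆ Metric.ball 0 1 := fun x hx => by
    simp only [Metric.mem_closedBall, Metric.mem_ball] at hx hz ⊢
    linarith [dist_triangle x z 0]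
  have hzK : z ∈ Metric.closedBall z (1 / 8) := Metric.mem_closedBall_self (by norm_num)
  have hΘ2 : ((n : ℝ) - 2) * Real.pi / 2 ≤ Θ := by rw [hn]; norm_num [hΘ]
  set t := Real.tan (Θ / 2) with ht
  set Λ : EuclideanSpace ℝ (Fin n) → ℝ := fun x => eigenvalue (hessian u x) 0 with hΛ
  have hpar : ∀ x ∈ Metric.ball 0 1, ∃ q, 0 ≤ q ∧ 0 ≤ t ∧ t * q < 1 ∧
      Λ x * (1 - t * q) = t + q ∧ eigenvalue (hessian u x) j₁ * (1 + t * q) = t - q :=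
    fun x hx => exists_halfangle_parameter hΘ (by have := hsol x hx; rwa [hsum] at this)
      (eigenvalue_antitone _ (Fin.zero_le _))
  have hden : ∀ x ∈ Metric.ball 0 1, 0 < 1 + t * Λ x := fun x hx => by
    obtain ⟨q, hq, ht0, htq, ha, -⟩ := hpar x hx
    have := le_of_halfangle hq ht0 htq ha
    nlinarith
  set Q : EuclideanSpace ℝ (Fin n) → ℝ := fun x => (Λ x - t) / (1 + t * Λ x) with hQ
  set ζ : EuclideanSpace ℝ (Fin n) → ℝ := fun x => (1 / 8) ^ 2 - ‖x - z‖ ^ 2 with hζ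
  -- Pogorelov-type quantity: `ζ` localizes, and `L (|Du|² / 2) = Σ lₖ² / (1 + lₖ²)` supplies the
  -- good term. At a positive maximum, `log ζ + |Du|² / 2` touches `-log Q` from below up to a
  -- constant.
  set F : EuclideanSpace ℝ (Fin n) → ℝ :=
    fun x => ζ x * Q x * Real.exp (1 / 2 * ‖fderiv ℝ u x‖ ^ 2) with hF
  have hΛc : ContinuousOn Λ (Metric.ball 0 1) := continuousOn_eigenvalue_zero hopen hu
  have hQc : ContinuousOn Q (Metric.ball 0 1) :=
    (hΛc.sub continuousOn_const).div (continuousOn_const.add (hΛc.const_mul t))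
      fun x hx => (hden x hx).ne'
  have hDc : ContinuousOn (fderiv ℝ u) (Metric.ball 0 1) :=
    hu.continuousOn_fderiv_of_isOpen hopen (by simp)
  have hζc : Continuous ζ := by fun_prop
  have hFc : ContinuousOn F (Metric.closedBall z (1 / 8)) :=
    ((hζc.continuousOn.mul hQc).mul (((hDc.norm.pow 2).const_mul (1 / 2)).rexp)).mono hsub
  obtain ⟨x, hxK, hmax⟩ := (isCompact_closedBall z (1 / 8)).exists_isMaxOn ⟨z, hzK⟩ hFc
  have hxS := hsub hxK
  change Q z ≤ _
  by_cases hQz : Q z ≤ 0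
  · exact hQz.trans (by positivity)
  push Not at hQz
  have hζz : ζ z = (1 / 8) ^ 2 := by simp [hζ]
  have hFz1 : (1 / 8) ^ 2 * Q z ≤ F z := by
    simp only [hF, hζz]
    have : 1 ≤ Real.exp (1 / 2 * ‖fderiv ℝ u z‖ ^ 2) := Real.one_le_exp (by positivity)
    exact le_mul_of_one_le_right (by positivity) this
  have hFz : 0 < F z := lt_of_lt_of_le (by positivity) hFz1
  have hFx : 0 < F x := hFz.trans_le (hmax hzK)
  have hζx0 : 0 ≤ ζ x := by
    rw [mem_closedBall_iff_norm] at hxK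
    simp only [hζ]
    have := pow_le_pow_left₀ (norm_nonneg _) hxK 2
    linarith
  have hprod : 0 < ζ x * Q x := pos_of_mul_pos_left hFx (Real.exp_pos _).le
  have hζx : 0 < ζ x := lt_of_le_of_ne hζx0 fun h => by rw [← h] at hprod; simp at hprod
  have hQx : 0 < Q x := pos_of_mul_pos_right hprod hζx0
  obtain ⟨q, hq, ht0, htq, ha, hb⟩ := hpar x hxS
  have hqQ : Q x = q := by
    simp only [hQ]
    rw [sub_eq_of_halfangle htq ha, mul_div_assoc, div_self (hden x hxS).ne', mul_one]
  have hq0 : 0 < q := hqQ ▸ hQx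
  have key : ζ x * q ≤ 7 / 8 := by
    obtain ⟨e, he⟩ := exists_eigenframe (hessian_isHermitian hopen hu hxS)
    set l := eigenvalue (hessian u x) with hl
    set W : EuclideanSpace ℝ (Fin n) → ℝ := fun w =>
      Real.log (ζ w) + 1 / 2 * (∑ i, dirDeriv (e i) u w * dirDeriv (e i) u w) - Real.log (F x)
      with hW
    have hWeq : ∀ w, W w = Real.log (ζ w) + 1 / 2 * ‖fderiv ℝ u w‖ ^ 2 - Real.log (F x) :=
      fun w => by
        simp only [hW, norm_sq_eq_sum_frame e, dirDeriv, sq]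
    have hjet : ∀ k, HasJet (fun s : ℝ => W (x + s • e k)) _ _ _ := fun k =>
      ((HasJet.comp (G := Real.log) (G' := fun a => a⁻¹) (G'' := -(ζ x ^ 2)⁻¹)
        (by filter_upwards [lt_mem_nhds hζx] with a ha using Real.hasDerivAt_log ha.ne')
        (hasDerivAt_inv hζx.ne')
        ((HasJet.const ((1 / 8 : ℝ) ^ 2)).sub (hasJet_normSq_frame e x z k))).add
      ((HasJet.sum Finset.univ fun i => (hasJet_gradient hopen hu hxS he i k).mul
        (hasJet_gradient hopen hu hxS he i k)).const_mul (1 / 2))).sub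
      (HasJet.const (Real.log (F x)))
    have hζnear : ∀ᶠ w in 𝓝 x, 0 < ζ w := hζc.continuousAt.eventually (lt_mem_nhds hζx)
    have hQnear : ∀ᶠ w in 𝓝 x, 0 < Q w :=
      (hQc.continuousAt (hopen.mem_nhds hxS)).eventually (lt_mem_nhds hQx)
    have hlog : ∀ w, 0 < ζ w → 0 < Q w → Real.log (F w) =
        Real.log (ζ w) + Real.log (Q w) + 1 / 2 * ‖fderiv ℝ u w‖ ^ 2 := fun w h1 h2 => by
      simp only [hF]
      rw [Real.log_mul (mul_pos h1 h2).ne' (Real.exp_pos _).ne', Real.log_mul h1.ne' h2.ne',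
        Real.log_exp]
    have hle := sum_mul_le_zero_of_jacobiAt hΘ2 hopen hu hsol hxS hl he
      (jacobiAt_neg_log hj hj' hsum (eigenvalue_antitone _ (Fin.zero_le _)) hq0 ht0 htq ha hb)
      hjet (by
        filter_upwards [hζnear, hQnear] with w h1 h2
        have hwK : w ∈ Metric.closedBall z (1 / 8) := by
          rw [mem_closedBall_iff_norm]
          simp only [hζ] at h1
          exact (sq_le_sq₀ (norm_nonneg _) (by norm_num)).1 (by linarith)
        have h3 : F w ≤ F x := hmax hwK
        have h4 := Real.log_le_log (mul_pos (mul_pos h1 h2) (Real.exp_pos _)) h3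
        rw [show ζ w * Q w * Real.exp (1 / 2 * ‖fderiv ℝ u w‖ ^ 2) = F w from rfl,
          hlog w h1 h2] at h4
        rw [hWeq]
        change _ ≤ -Real.log (Q w)
        linarith) (by
        rw [hWeq, hlog x hζx hQx]
        change _ = -Real.log (Q x)
        ring)
    have hvar : ∑ k, (1 + l k ^ 2)⁻¹ * ∑ i, dirDeriv (e i) u x * thirdDeriv u x e k k i = 0 := by
      simp only [Finset.mul_sum]
      rw [Finset.sum_comm]
      refine Finset.sum_eq_zero fun i _ => ?_
      have := (equation_variation_frame hopen hu hsol hxS he i).1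
      simp only [mul_left_comm _ (dirDeriv _ _ _), ← Finset.mul_sum]
      rw [this, mul_zero]
    have hξ : ∀ k, inner ℝ (e k) (x - z) ^ 2 ≤ (1 / 8 : ℝ) ^ 2 := fun k => by
      have h1 := abs_real_inner_le_norm (e k) (x - z)
      rw [e.orthonormal.1 k, one_mul] at h1
      rw [mem_closedBall_iff_norm] at hxK
      rw [← sq_abs]
      exact pow_le_pow_left₀ (abs_nonneg _) (h1.trans hxK) 2
    have hζle : ζ x ≤ (1 / 8) ^ 2 := by simp only [hζ]; linarith [sq_nonneg ‖x - z‖]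
    -- The second derivatives of `log ζ` are `-2 / ζ - 4 ξₖ² / ζ²`, bounded below by `-(2 + 4)
    -- (1/8)² / ζ²`.
    have hsum2 : ∑ k, (1 + l k ^ 2)⁻¹ * (l k ^ 2 - 6 * (1 / 8) ^ 2 / ζ x ^ 2) ≤ 0 := by
      have hadd : ∑ k, (1 + l k ^ 2)⁻¹ * (l k ^ 2 - 6 * (1 / 8) ^ 2 / ζ x ^ 2) =
          ∑ k, (1 + l k ^ 2)⁻¹ * (l k ^ 2 - 6 * (1 / 8) ^ 2 / ζ x ^ 2 +
            ∑ i, dirDeriv (e i) u x * thirdDeriv u x e k k i) := by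
        simp only [mul_add _ (l _ ^ 2 - _), Finset.sum_add_distrib]
        rw [hvar, add_zero]
      rw [hadd]
      refine le_trans (Finset.sum_le_sum fun k _ =>
        mul_le_mul_of_nonneg_left ?_ (by positivity)) hle
      have e1 : ∑ i, (thirdDeriv u x e k k i * dirDeriv (e i) u x +
          2 * (if i = k then l k else 0) * (if i = k then l k else 0) +
          dirDeriv (e i) u x * thirdDeriv u x e k k i) =
          2 * ∑ i, dirDeriv (e i) u x * thirdDeriv u x e k k i + 2 * l k ^ 2 := by
        simp only [Finset.sum_add_distrib, mul_comm (thirdDeriv u x e k k _)]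
        simp
        ring
      rw [e1]
      have e3 : (ζ x)⁻¹ ≤ (1 / 8) ^ 2 / ζ x ^ 2 := by
        rw [inv_eq_one_div, div_le_div_iff₀ hζx (by positivity)]
        nlinarith
      have e4 : (ζ x ^ 2)⁻¹ * inner ℝ (e k) (x - z) ^ 2 ≤ (1 / 8) ^ 2 / ζ x ^ 2 := by
        rw [inv_mul_eq_div]
        exact div_le_div_of_nonneg_right (hξ k) (by positivity)
      have e5 : 6 * (1 / 8 : ℝ) ^ 2 / ζ x ^ 2 = 6 * ((1 / 8) ^ 2 / ζ x ^ 2) := mul_div_assoc _ _ _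
      rw [e5]
      linear_combination 4 * e4 + 2 * e3
    rw [hsum] at hsum2
    set B := 6 * (1 / 8 : ℝ) ^ 2 / ζ x ^ 2 with hB
    have hBpos : 0 < B := by positivity
    have hfin := sq_le_of_halfangle hq ht0 htq ha hb hBpos.le hsum2
    have h6 : (ζ x * q) ^ 2 ≤ (7 / 8) ^ 2 := by
      have : ζ x ^ 2 * (B * 5) = 30 / 64 := by
        rw [hB]; field_simp; norm_num
      have h7 := mul_le_mul_of_nonneg_left hfin (sq_nonneg (ζ x))
      rw [this] at h7
      rw [mul_pow]
      linarith
    exact (sq_le_sq₀ (mul_nonneg hζx0 hq) (by norm_num)).1 h6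
  have hFx' : F x ≤ 7 / 8 * Real.exp (1 / 2 * A ^ 2) := by
    simp only [hF, hqQ]
    refine mul_le_mul key (Real.exp_le_exp.2 ?_) (Real.exp_pos _).le (by norm_num)
    have := pow_le_pow_left₀ (norm_nonneg _) (hbd x hxS) 2
    linarith
  have := hFz1.trans ((hmax hzK : F z ≤ F x).trans hFx')
  linarith

end TwoDim


/-! ### Translation between suprema, matrix norms, exponents and pointwise bounds. -/

section Supremum

variable {X : Type*} {s t : Set X} {f : X → ℝ}

theorem supOn_le_mul_supOn {C : ℝ≥0} (h : ∀ z ∈ s, ∃ x ∈ t, f z ≤ C * f x) :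
    supOn s f ≤ C * supOn t f := by
  refine iSup₂_le fun z hz => ?_
  obtain ⟨x, hx, hzx⟩ := h z hz
  calc ENNReal.ofReal (f z) ≤ ENNReal.ofReal (C * f x) := ENNReal.ofReal_le_ofReal hzx
    _ = C * ENNReal.ofReal (f x) := by
      rw [ENNReal.ofReal_mul C.coe_nonneg, ENNReal.ofReal_coe_nnreal]
    _ ≤ C * supOn t f :=
      mul_le_mul_right (le_iSup₂ (f := fun x (_ : x ∈ t) => ENNReal.ofReal (f x)) x hx) _

theorem supOn_le_coe_iff {K : ℝ≥0} : supOn s f ≤ K ↔ ∀ x ∈ s, f x ≤ K := by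
  simp [supOn, iSup_le_iff, ENNReal.ofReal_le_coe]

end Supremum

section MatrixNorm

variable {n : ℕ} {M : Matrix (Fin n) (Fin n) ℝ}

theorem abs_eigenvalue_le_matrixNorm (hM : M.IsHermitian) (i : Fin n) :
    |eigenvalue M i| ≤ matrixNorm M := by
  rw [matrixNorm_eq hM]
  exact Real.abs_le_sqrt
    (Finset.single_le_sum (f := fun i => eigenvalue M i ^ 2) (fun _ _ => sq_nonneg _)
      (Finset.mem_univ i))

theorem matrixNorm_le (hM : M.IsHermitian) {B : ℝ} (hB : 0 ≤ B)
    (h : ∀ i, |eigenvalue M i| ≤ B) : matrixNorm M ≤ √n * B := by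
  rw [matrixNorm_eq hM]
  refine Real.sqrt_le_iff.2 ⟨by positivity, ?_⟩
  calc ∑ i, eigenvalue M i ^ 2 ≤ ∑ _i : Fin n, B ^ 2 :=
        Finset.sum_le_sum fun i _ => sq_le_sq' (abs_le.1 (h i)).1 (abs_le.1 (h i)).2
    _ = (√n * B) ^ 2 := by
      rw [mul_pow, Real.sq_sqrt (Nat.cast_nonneg n)]
      simp

end MatrixNorm

section Exponent

/-- Equivalent to `√(4n + 1) ≤ 2n - 1`, an equality at `n = 2`. The prescribed exponent thus lies in
the range allowed by `jacobiAt_exp`. -/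
theorem jacobiExponent_le {n : ℕ} (hn : 2 ≤ n) : jacobiExponent n ≤ 1 - 2 / n := by
  have hn' : (2 : ℝ) ≤ n := by exact_mod_cast hn
  have h : √(4 * (n : ℝ) + 1) ≤ 2 * n - 1 := Real.sqrt_le_iff.2 ⟨by linarith, by nlinarith⟩
  have h2 : 2 / (n : ℝ) ≤ 4 / (√(4 * (n : ℝ) + 1) + 1) := by
    rw [div_le_div_iff₀ (by positivity) (by positivity)]
    linarith
  unfold jacobiExponent
  linarith

theorem jacobiExponent_pos {n : ℕ} (hn : 3 ≤ n) : 0 < jacobiExponent n := by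
  have hn' : (3 : ℝ) ≤ n := by exact_mod_cast hn
  have h : 3 < √(4 * (n : ℝ) + 1) := Real.lt_sqrt_of_sq_lt (by linarith)
  have h2 : 4 / (√(4 * (n : ℝ) + 1) + 1) < 1 := by
    rw [div_lt_one (by positivity)]
    linarith
  unfold jacobiExponent
  linarith

theorem jacobiExponent_two : jacobiExponent 2 = 0 := by
  have h : √(4 * ((2 : ℕ) : ℝ) + 1) = 3 := by
    rw [Real.sqrt_eq_iff_mul_self_eq (by norm_num) (by norm_num)]
    norm_num
  rw [jacobiExponent, h]
  norm_num

theorem a₁_eq_inv {n : ℕ} [NeZero n] (M : Matrix (Fin n) (Fin n) ℝ) :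
    a₁ M = (Real.exp (-(jacobiExponent n / 2 * Real.log (1 + eigenvalue M 0 ^ 2))))⁻¹ := by
  rw [a₁, b₁, Real.log_sqrt (by positivity), ← Real.exp_neg]
  congr 1
  ring

end Exponent

/-! ### Solutions with bounded gradient: dominance and sign of `λ₁`. -/

/-- A smooth solution in the unit ball with phase at least `(n - 2) π / 2` and with values and
gradient bounded by `A`. -/
structure IsBoundedSolution {n : ℕ} (Θ A : ℝ) (u : EuclideanSpace ℝ (Fin n) → ℝ) : Prop where
  phase : ((n : ℝ) - 2) * Real.pi / 2 ≤ Θ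
  contDiffOn : ContDiffOn ℝ ∞ u (Metric.ball 0 1)
  isSolutionOn : IsSolutionOn Θ u (Metric.ball 0 1)
  bound : ∀ x ∈ Metric.ball 0 1, |u x| ≤ A ∧ ‖fderiv ℝ u x‖ ≤ A

namespace IsBoundedSolution

variable {n : ℕ} {Θ A : ℝ} {u : EuclideanSpace ℝ (Fin n) → ℝ}
  {x y z : EuclideanSpace ℝ (Fin n)} {r : ℝ}

theorem of_c01Norm_le {A : ℝ≥0} (hΘ : ((n : ℝ) - 2) * Real.pi / 2 ≤ Θ)
    (hu : ContDiffOn ℝ ∞ u (Metric.ball 0 2)) (hsol : IsSolutionOn Θ u (Metric.ball 0 2))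
    (hA : c01Norm u (Metric.ball 0 1) ≤ A) : IsBoundedSolution Θ A u :=
  have hsub : Metric.ball (0 : EuclideanSpace ℝ (Fin n)) 1 ⊆ Metric.ball 0 2 :=
    Metric.ball_subset_ball (by norm_num)
  ⟨hΘ, hu.mono hsub, fun x hx => hsol x (hsub hx),
    fun _ hx => bounds_of_c01Norm_le Metric.isOpen_ball hA hx⟩

theorem mem_ball_of_mem (hy : y ∈ Metric.ball (0 : EuclideanSpace ℝ (Fin n)) (1 / 2))
    (hr : r ≤ 1 / 4) (hx : x ∈ Metric.ball y r) : x ∈ Metric.ball 0 (3 / 4) := by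
  simp only [Metric.mem_ball] at hx hy ⊢
  linarith [dist_triangle x y 0]

theorem mem_unit_ball_of_mem (hy : y ∈ Metric.ball (0 : EuclideanSpace ℝ (Fin n)) (1 / 2))
    (hr : r ≤ 1 / 4) (hx : x ∈ Metric.ball y r) : x ∈ Metric.ball 0 1 :=
  Metric.ball_subset_ball (by norm_num) (mem_ball_of_mem hy hr hx)

theorem isHermitian (h : IsBoundedSolution Θ A u) (hx : x ∈ Metric.ball 0 1) :
    (hessian u x).IsHermitian :=
  hessian_isHermitian Metric.isOpen_ball h.contDiffOn hx

variable [NeZero n]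

theorem abs_eigenvalue_le (h : IsBoundedSolution Θ A u) (hn : 2 ≤ n)
    (hx : x ∈ Metric.ball 0 1) (i : Fin n) :
    |eigenvalue (hessian u x) i| ≤ eigenvalue (hessian u x) 0 := by
  have hanti : ∀ j, eigenvalue (hessian u x) j ≤ eigenvalue (hessian u x) 0 :=
    fun j => eigenvalue_antitone _ (Fin.zero_le _)
  have hadd : ∀ j, 0 ≠ j → 0 ≤ eigenvalue (hessian u x) 0 + eigenvalue (hessian u x) j :=
    fun j => add_nonneg_of_phase h.phase (h.isSolutionOn x hx)
  by_cases hi : i = 0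
  · have : Nontrivial (Fin n) := Fin.nontrivial_iff_two_le.2 hn
    obtain ⟨j, hj⟩ := exists_ne (0 : Fin n)
    rw [hi, abs_of_nonneg (by linarith [hadd j hj.symm, hanti j])]
  · exact abs_le.2 ⟨by linarith [hadd i (Ne.symm hi)], hanti i⟩

theorem eigenvalue_pos (h : IsBoundedSolution Θ A u) (hn : 3 ≤ n)
    (hx : x ∈ Metric.ball 0 1) : 0 < eigenvalue (hessian u x) 0 := by
  by_contra! h0
  have h1 : ∑ i, Real.arctan (eigenvalue (hessian u x) i) ≤ 0 :=
    Finset.sum_nonpos fun i _ => by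
      rw [← Real.arctan_zero]
      exact Real.arctan_strictMono.monotone
        ((eigenvalue_antitone _ (Fin.zero_le i)).trans h0)
  rw [h.isSolutionOn x hx] at h1
  have hn' : (3 : ℝ) ≤ n := by exact_mod_cast hn
  have h2 : 0 < ((n : ℝ) - 2) * Real.pi / 2 := by
    have : 0 < (n : ℝ) - 2 := by linarith
    positivity
  linarith [h.phase]

theorem matrixNorm_le_of_eigenvalue_le (h : IsBoundedSolution Θ A u) (hn : 2 ≤ n)
    (hx : x ∈ Metric.ball 0 1) {B : ℝ} (hB : eigenvalue (hessian u x) 0 ≤ B) :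
    matrixNorm (hessian u x) ≤ √n * B :=
  matrixNorm_le (h.isHermitian hx)
    ((abs_nonneg _).trans ((h.abs_eigenvalue_le hn hx 0).trans hB))
    fun i => (h.abs_eigenvalue_le hn hx i).trans hB

theorem continuousOn_eigenvalue (h : IsBoundedSolution Θ A u) :
    ContinuousOn (fun x => eigenvalue (hessian u x) 0) (Metric.ball 0 1) :=
  continuousOn_eigenvalue_zero Metric.isOpen_ball h.contDiffOn

theorem eigenvalue_eq_of_one (h : IsBoundedSolution Θ A u) (hn : n = 1)
    (hx : x ∈ Metric.ball 0 1) (hz : z ∈ Metric.ball 0 1) :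
    eigenvalue (hessian u x) = eigenvalue (hessian u z) := by
  subst hn
  have key : ∀ w ∈ Metric.ball 0 1, eigenvalue (hessian u w) 0 = Real.tan Θ := fun w hw => by
    have := h.isSolutionOn w hw
    rw [Fin.sum_univ_one] at this
    rw [← this, Real.tan_arctan]
  funext i
  rw [Subsingleton.elim i 0, key x hx, key z hz]

end IsBoundedSolution

/-! ### The estimates by dimension. -/

section Estimates

variable (n : ℕ) [NeZero n] {r A : ℝ}

theorem exists_a₁_le (hr0 : 0 < r) (hr : r < 1 / 4) (hA : 0 ≤ A) :
    ∃ C : ℝ≥0, ∀ (Θ : ℝ) (u : EuclideanSpace ℝ (Fin n) → ℝ) (y : EuclideanSpace ℝ (Fin n)),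
      IsBoundedSolution Θ A u → y ∈ Metric.ball 0 (1 / 2) →
      ∀ z ∈ Metric.ball y (1 / 4), ∃ x ∈ Metric.ball y r,
        a₁ (hessian u z) ≤ C * a₁ (hessian u x) := by
  have h3 : n = 1 ∨ n = 2 ∨ 3 ≤ n := by have := NeZero.ne n; omega
  rcases h3 with hn | hn | hn
  · refine ⟨1, fun Θ u y h hy z hz => ⟨y, Metric.mem_ball_self hr0, ?_⟩⟩
    have := h.eigenvalue_eq_of_one hn (IsBoundedSolution.mem_unit_ball_of_mem hy le_rfl hz)
      (IsBoundedSolution.mem_unit_ball_of_mem hy hr.le (Metric.mem_ball_self hr0))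
    simp [a₁_eq_inv, this]
  · refine ⟨1, fun Θ u y h hy z hz => ⟨y, Metric.mem_ball_self hr0, ?_⟩⟩
    have : jacobiExponent n = 0 := by rw [hn, jacobiExponent_two]
    simp [a₁_eq_inv, this]
  · obtain ⟨C, hC0, hC⟩ := exists_doubling_constant n hr0 hr hA
    refine ⟨C.toNNReal, fun Θ u y h hy z hz => ?_⟩
    obtain ⟨x, hx, hxz⟩ := hC Θ u y
      (fun y => Real.exp (-(jacobiExponent n / 2 * Real.log (1 + y ^ 2))))
      h.phase h.contDiffOn h.isSolutionOn h.bound hy (fun x hx => Real.exp_pos _)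
      ((((h.continuousOn_eigenvalue.pow 2).const_add 1).log
        fun x hx => (add_pos_of_pos_of_nonneg one_pos (sq_nonneg _)).ne').const_mul _).neg.rexp
      (fun x hx => jacobiAt_exp (by omega) h.phase (h.isSolutionOn x hx)
        (fun j => eigenvalue_antitone _ (Fin.zero_le j)) (h.eigenvalue_pos hn hx)
        (jacobiExponent_pos hn).le (jacobiExponent_le (by omega))) z hz
    refine ⟨x, hx, ?_⟩
    rw [a₁_eq_inv, a₁_eq_inv, Real.coe_toNNReal C hC0, ← div_eq_mul_inv, inv_eq_one_div,
      div_le_div_iff₀ (Real.exp_pos _) (Real.exp_pos _), one_mul]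
    exact hxz

theorem exists_eigenvalue_le_of_three_le (hn : 3 ≤ n) (hr0 : 0 < r) (hr : r < 1 / 4)
    (hA : 0 ≤ A) (K : ℝ) :
    ∃ B : ℝ, ∀ (Θ : ℝ) (u : EuclideanSpace ℝ (Fin n) → ℝ) (y : EuclideanSpace ℝ (Fin n)),
      IsBoundedSolution Θ A u → y ∈ Metric.ball 0 (1 / 2) →
      (∀ x ∈ Metric.ball y r, eigenvalue (hessian u x) 0 ≤ K) →
      ∀ z ∈ Metric.ball y (1 / 4), eigenvalue (hessian u z) 0 ≤ B := by
  obtain ⟨C, hC⟩ := exists_a₁_le n hr0 hr hA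
  have hε := jacobiExponent_pos hn
  set ε := jacobiExponent n with hεdef
  set D : ℝ := C * Real.exp (ε / 2 * Real.log (1 + K ^ 2)) with hD
  -- Inverts `(1 + λ₁²)^{ε/2} ≤ D`, which is possible because `ε > 0` for `n ≥ 3`.
  refine ⟨√(Real.exp (2 / ε * Real.log D)), fun Θ u y h hy hK z hz => ?_⟩
  obtain ⟨x, hx, hzx⟩ := hC Θ u y h hy z hz
  have hx1 := IsBoundedSolution.mem_unit_ball_of_mem hy hr.le hx
  have ha : ∀ w, a₁ (hessian u w) =
      Real.exp (ε / 2 * Real.log (1 + eigenvalue (hessian u w) 0 ^ 2)) := fun w => by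
    rw [a₁_eq_inv, ← Real.exp_neg, neg_neg]
  rw [ha, ha] at hzx
  have h1 : Real.exp (ε / 2 * Real.log (1 + eigenvalue (hessian u z) 0 ^ 2)) ≤ D := by
    refine hzx.trans (mul_le_mul_of_nonneg_left (Real.exp_le_exp.2 ?_) C.coe_nonneg)
    have h2 := h.eigenvalue_pos hn hx1
    have h3 := pow_le_pow_left₀ h2.le (hK x hx) 2
    exact mul_le_mul_of_nonneg_left (Real.log_le_log (by positivity) (by linarith))
      (by positivity)
  have h2 := Real.log_le_log (Real.exp_pos _) h1
  rw [Real.log_exp] at h2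
  have h3 : Real.log (1 + eigenvalue (hessian u z) 0 ^ 2) ≤ 2 / ε * Real.log D := by
    rw [div_mul_eq_mul_div, le_div_iff₀ hε]
    linarith
  refine Real.le_sqrt_of_sq_le ?_
  have h4 := (Real.log_le_iff_le_exp (by positivity)).1 h3
  linarith

theorem exists_eigenvalue_le_of_two (hn : n = 2) (hr0 : 0 < r) (hr : r < 1 / 4)
    (hA : 0 ≤ A) (K : ℝ) :
    ∃ B : ℝ, ∀ (Θ : ℝ) (u : EuclideanSpace ℝ (Fin n) → ℝ) (y : EuclideanSpace ℝ (Fin n)),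
      IsBoundedSolution Θ A u → y ∈ Metric.ball 0 (1 / 2) →
      (∀ x ∈ Metric.ball y r, eigenvalue (hessian u x) 0 ≤ K) →
      ∀ z ∈ Metric.ball y (1 / 4), eigenvalue (hessian u z) 0 ≤ B := by
  obtain ⟨C, hC0, hC⟩ := exists_doubling_constant n hr0 hr hA
  obtain ⟨j₁, hj, hj', hsum⟩ := exists_sum_eq_of_eq_two hn
  -- From `λ₁ = t + q (1 + t λ₁)` at `z`. A point of `B_r(y)` gives `0 ≤ t ≤ λ₁ ≤ K`, hence `1 + t
  -- λ₁ ≤ 1 + K²` there; doubling carries this to `z`, and `halfangle_bound` controls `q`. No bound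
  -- on `t` is assumed beforehand, so `Θ` may approach `π`.
  refine ⟨K + 56 * Real.exp (1 / 2 * A ^ 2) * (C * (1 + K ^ 2)), fun Θ u y h hy hK z hz => ?_⟩
  have hΘ : 0 ≤ Θ := by have := h.phase; rw [hn] at this; norm_num at this; exact this
  have hpar := fun x hx => exists_halfangle_parameter hΘ
    (by have := h.isSolutionOn x hx; rwa [hsum] at this)
    (eigenvalue_antitone (hessian u x) (Fin.zero_le j₁))
  have hbound := halfangle_bound hn hΘ h.contDiffOn h.isSolutionOn (fun x hx => (h.bound x hx).2)
    (IsBoundedSolution.mem_ball_of_mem hy le_rfl hz)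
  set t := Real.tan (Θ / 2) with ht
  have hle : ∀ x ∈ Metric.ball 0 1, 0 ≤ t ∧ t ≤ eigenvalue (hessian u x) 0 ∧
      0 < 1 + t * eigenvalue (hessian u x) 0 := fun x hx => by
    obtain ⟨q, hq, ht0, htq, ha, -⟩ := hpar x hx
    have h1 := le_of_halfangle hq ht0 htq ha
    have h2 : t ≤ eigenvalue (hessian u x) 0 := by linarith
    exact ⟨ht0, h2, by nlinarith⟩
  obtain ⟨x, hx, hxz⟩ := hC Θ u y (fun y => (1 + t * y)⁻¹)
    h.phase h.contDiffOn h.isSolutionOn h.bound hy (fun x hx => inv_pos.2 (hle x hx).2.2)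
    ((h.continuousOn_eigenvalue.const_mul t).const_add 1 |>.inv₀ fun x hx => (hle x hx).2.2.ne')
    (fun x hx => by
      obtain ⟨q, hq, ht0, htq, ha, hb⟩ := hpar x hx
      exact jacobiAt_inv hj hj' hsum (eigenvalue_antitone _ (Fin.zero_le _)) hq ht0 htq ha hb)
    z hz
  obtain ⟨ht0, htx, hposx⟩ := hle x (IsBoundedSolution.mem_unit_ball_of_mem hy hr.le hx)
  obtain ⟨-, htz, hposz⟩ := hle z (IsBoundedSolution.mem_unit_ball_of_mem hy le_rfl hz)
  have hKx := hK x hx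
  simp only [inv_eq_one_div] at hxz
  rw [mul_one_div, div_le_div_iff₀ hposx hposz, one_mul] at hxz
  have h1 : 1 + t * eigenvalue (hessian u x) 0 ≤ 1 + K ^ 2 := by nlinarith
  have h2 := hxz.trans (mul_le_mul_of_nonneg_left h1 hC0)
  rw [div_le_iff₀ hposz] at hbound
  have h3 := mul_le_mul_of_nonneg_left h2
    (by positivity : 0 ≤ 56 * Real.exp (1 / 2 * A ^ 2))
  linarith

theorem exists_matrixNorm_le (hr0 : 0 < r) (hr : r < 1 / 4) (hA : 0 ≤ A) (K : ℝ) :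
    ∃ C : ℝ≥0, ∀ (Θ : ℝ) (u : EuclideanSpace ℝ (Fin n) → ℝ) (y : EuclideanSpace ℝ (Fin n)),
      IsBoundedSolution Θ A u → y ∈ Metric.ball 0 (1 / 2) →
      (∀ x ∈ Metric.ball y r, matrixNorm (hessian u x) ≤ K) →
      ∀ z ∈ Metric.ball y (1 / 4), matrixNorm (hessian u z) ≤ C := by
  have h3 : n = 1 ∨ 2 ≤ n := by have := NeZero.ne n; omega
  rcases h3 with hn | hn
  · refine ⟨K.toNNReal, fun Θ u y h hy hK z hz =>
      (le_trans ?_ (hK y (Metric.mem_ball_self hr0))).trans (Real.le_coe_toNNReal K)⟩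
    have hz1 := IsBoundedSolution.mem_unit_ball_of_mem hy le_rfl hz
    have hy1 := IsBoundedSolution.mem_unit_ball_of_mem hy hr.le (Metric.mem_ball_self hr0)
    rw [matrixNorm_eq (h.isHermitian hz1), matrixNorm_eq (h.isHermitian hy1),
      h.eigenvalue_eq_of_one hn hz1 hy1]
  · obtain ⟨B, hB⟩ : ∃ B : ℝ, ∀ (Θ : ℝ) (u : EuclideanSpace ℝ (Fin n) → ℝ)
        (y : EuclideanSpace ℝ (Fin n)), IsBoundedSolution Θ A u → y ∈ Metric.ball 0 (1 / 2) →
        (∀ x ∈ Metric.ball y r, eigenvalue (hessian u x) 0 ≤ K) →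
        ∀ z ∈ Metric.ball y (1 / 4), eigenvalue (hessian u z) 0 ≤ B := by
      rcases hn.eq_or_lt with h2 | h2
      · exact exists_eigenvalue_le_of_two n h2.symm hr0 hr hA K
      · exact exists_eigenvalue_le_of_three_le n h2 hr0 hr hA K
    refine ⟨(√n * B).toNNReal, fun Θ u y h hy hK z hz => le_trans ?_ (Real.le_coe_toNNReal _)⟩
    refine h.matrixNorm_le_of_eigenvalue_le hn
      (IsBoundedSolution.mem_unit_ball_of_mem hy le_rfl hz) (hB Θ u y h hy (fun x hx => ?_) z hz)
    exact (le_abs_self _).trans ((abs_eigenvalue_le_matrixNorm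
      (h.isHermitian (IsBoundedSolution.mem_unit_ball_of_mem hy hr.le hx)) 0).trans (hK x hx))

end Estimates

end SLag

end

theorem mainTheorem4 (n : ℕ) [NeZero n] (r : ℝ) (hr0 : 0 < r) (hr : r < 1 / 4) (A : ℝ≥0) :
    (∃ C : ℝ≥0, ∀ (Θ : ℝ) (u : EuclideanSpace ℝ (Fin n) → ℝ) (y : EuclideanSpace ℝ (Fin n)),
      ((n : ℝ) - 2) * Real.pi / 2 ≤ Θ →
      ContDiffOn ℝ ∞ u (Metric.ball 0 2) →
      SLag.IsSolutionOn Θ u (Metric.ball 0 2) →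
      SLag.c01Norm u (Metric.ball 0 1) ≤ A →
      y ∈ Metric.ball 0 (1 / 2) →
      SLag.supOn (Metric.ball y (1 / 4)) (fun x => SLag.a₁ (SLag.hessian u x)) ≤
        C * SLag.supOn (Metric.ball y r) (fun x => SLag.a₁ (SLag.hessian u x))) ∧
    (∀ K : ℝ≥0, ∃ C : ℝ≥0,
      ∀ (Θ : ℝ) (u : EuclideanSpace ℝ (Fin n) → ℝ) (y : EuclideanSpace ℝ (Fin n)),
      ((n : ℝ) - 2) * Real.pi / 2 ≤ Θ →
      ContDiffOn ℝ ∞ u (Metric.ball 0 2) →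
      SLag.IsSolutionOn Θ u (Metric.ball 0 2) →
      SLag.c01Norm u (Metric.ball 0 1) ≤ A →
      y ∈ Metric.ball 0 (1 / 2) →
      SLag.supOn (Metric.ball y r) (fun x => SLag.matrixNorm (SLag.hessian u x)) ≤ K →
      SLag.supOn (Metric.ball y (1 / 4)) (fun x => SLag.matrixNorm (SLag.hessian u x)) ≤ C) := by
  refine ⟨?_, fun K => ?_⟩
  · obtain ⟨C, hC⟩ := SLag.exists_a₁_le n hr0 hr A.coe_nonneg
    exact ⟨C, fun Θ u y hΘ hu hsol hA hy => SLag.supOn_le_mul_supOn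
      (hC Θ u y (.of_c01Norm_le hΘ hu hsol hA) hy)⟩
  · obtain ⟨C, hC⟩ := SLag.exists_matrixNorm_le n hr0 hr A.coe_nonneg K
    exact ⟨C, fun Θ u y hΘ hu hsol hA hy hK => SLag.supOn_le_coe_iff.2
      (hC Θ u y (.of_c01Norm_le hΘ hu hsol hA) hy (SLag.supOn_le_coe_iff.1 hK))⟩
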